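/- Let $\mathbb N=\{1,2,\dots\}$ and let $s$ be the space of rapidly decreasing sequences, that is, of all $\xi\in\mathbb C^{\mathbb N}$ with $|\xi|_q:=\bigl(\sum_j|\xi_j|^2j^{2q}\bigr)^{1/2}<\infty$ for every $q\in\mathbb N_0$. With the topology of the norms $|\cdot|_q$, pointwise multiplication and complex conjugation, $s$ is a Fréchet ${}^*$-algebra. Let $s'$ be its dual, identified with the space of all sequences $\eta$ with $|\eta|'_q:=\bigl(\sum_j|\eta_j|^2j^{-2q}\bigr)^{1/2}<\infty$ for some $q\in\mathbb N_0$, with the locally convex inductive limit topology, and put $\langle\xi,\eta\rangle=\sum_j\xi_j\overline{\eta_j}$. Let $\mathcal L(s',s)$ be the space of continuous linear maps $s'\to s$ with the topology of uniform convergence on bounded subsets of $s'$. It is a ${}^*$-algebra with the product $xy=x\circ j\circ y$, where $j\colon s\hookrightarrow s'$ is the inclusion, and with the involution $x\mapsto x^*$ given by the hermitian adjoint on $\ell_2$. For $k\in\mathbb N$ let $m_k$ be the $k$-th prime number, $N_{k,1}:=m_k$ and $N_{k,j+1}:=m_k^{N_{k,j}}$ for $j\in\mathbb N$, and let $$a_{k,j}:=c_k\,\frac{\prod_{i=1}^{j-1}N_{k,i}}{N_{k,j}^{\,j-1}},\qquad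 c_k:=\Bigl(\sum_{j=1}^\infty\Bigl(\frac{\prod_{i=1}^{j-1}N_{k,i}}{N_{k,j}^{\,j-1}}\Bigr)^2\Bigr)^{-1/2}.$$ **Theorem.** For every $k\in\mathbb N$ the series $f_k:=\sum_{j=1}^\infty a_{k,j}e_{N_{k,j}}$ converges in $s$ (where $e_n$ is the $n$-th unit sequence), and $(f_k)_{k\in\mathbb N}$ is orthonormal in $\ell_2$. The closed ${}^*$-subalgebra $E$ of $\mathcal L(s',s)$ generated by the operators $\langle\cdot,f_k\rangle f_k$, $k\in\mathbb N$, is commutative, and it is not isomorphic to any closed ${}^*$-subalgebra $F$ of $s$: there is no Fréchet ${}^*$-algebra isomorphism (a linear, multiplicative, ${}^*$-preserving homeomorphism) from $E$ onto $F$, and not even an isomorphism of complex algebras (a linear multiplicative bijection). In particular, there is a closed commutative ${}^*$-subalgebra of $\mathcal L(s',s)$ that is not isomorphic to any closed ${}^*$-subalgebra of $s$. -/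

import Mathlib

namespace SmoothOp

open scoped ComplexConjugate

noncomputable section

/-! ### Weighted `ℓ₂`-norms of sequences indexed by `{1, 2, 3, …}` -/

/-- `∑_j |ξ_j|² j^{2q} < ∞`, for an integer `q`. -/
def WSum (q : ℤ) (ξ : ℕ+ → ℂ) : Prop :=
  Summable fun j : ℕ+ => ‖ξ j‖ ^ 2 * (j : ℝ) ^ (2 * q)

/-- `(∑_j |ξ_j|² j^{2q})^{1/2}`, for an integer `q` (used only where `WSum q ξ` holds). -/
def wnorm (q : ℤ) (ξ : ℕ+ → ℂ) : ℝ :=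
  √(∑' j : ℕ+, ‖ξ j‖ ^ 2 * (j : ℝ) ^ (2 * q))

/-- The pairing `⟨ξ, η⟩ = ∑_j ξ_j \overline{η_j}`. -/
def pair (ξ η : ℕ+ → ℂ) : ℂ := ∑' j : ℕ+, ξ j * conj (η j)

theorem pnat_pos (j : ℕ+) : (0 : ℝ) < (j : ℝ) := by exact_mod_cast j.pos

theorem one_le_pnat (j : ℕ+) : (1 : ℝ) ≤ (j : ℝ) := by exact_mod_cast PNat.pos j

theorem wterm_eq (q : ℤ) (ξ : ℕ+ → ℂ) (j : ℕ+) :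
    ‖ξ j‖ ^ 2 * (j : ℝ) ^ (2 * q) = (‖ξ j‖ * (j : ℝ) ^ q) ^ 2 := by
  rw [mul_pow, ← zpow_natCast ((j : ℝ) ^ q) 2, ← zpow_mul, mul_comm q]; norm_num

theorem wterm_nonneg (q : ℤ) (ξ : ℕ+ → ℂ) (j : ℕ+) :
    0 ≤ ‖ξ j‖ ^ 2 * (j : ℝ) ^ (2 * q) := by rw [wterm_eq]; positivity

theorem wnorm_nonneg (q : ℤ) (ξ : ℕ+ → ℂ) : 0 ≤ wnorm q ξ := Real.sqrt_nonneg _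

theorem wsum_zero (q : ℤ) : WSum q 0 := by
  simp [WSum]

theorem wnorm_zero (q : ℤ) : wnorm q 0 = 0 := by simp [wnorm]

theorem WSum.smul {q : ℤ} {ξ : ℕ+ → ℂ} (h : WSum q ξ) (c : ℂ) : WSum q (c • ξ) := by
  have := Summable.mul_left (‖c‖ ^ 2) h
  refine this.congr fun j => ?_
  simp only [Pi.smul_apply, smul_eq_mul, norm_mul]; ring

theorem wnorm_smul (q : ℤ) (c : ℂ) (ξ : ℕ+ → ℂ) : wnorm q (c • ξ) = ‖c‖ * wnorm q ξ := by
  have : ∀ j : ℕ+, ‖(c • ξ) j‖ ^ 2 * (j : ℝ) ^ (2 * q)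
      = ‖c‖ ^ 2 * (‖ξ j‖ ^ 2 * (j : ℝ) ^ (2 * q)) := fun j => by
    simp only [Pi.smul_apply, smul_eq_mul, norm_mul]; ring
  rw [wnorm, tsum_congr this, tsum_mul_left, Real.sqrt_mul (by positivity),
    Real.sqrt_sq (norm_nonneg _), wnorm]

theorem WSum.add_aux {q : ℤ} {ξ η : ℕ+ → ℂ} (h : WSum q ξ) (h' : WSum q η) :
    WSum q (ξ + η) ∧ wnorm q (ξ + η) ≤ wnorm q ξ + wnorm q η := by
  have hf : Summable fun j : ℕ+ => (‖ξ j‖ * (j : ℝ) ^ q) ^ (2 : ℝ) := by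
    refine Summable.congr h fun j => ?_
    rw [wterm_eq]; norm_cast
  have hg : Summable fun j : ℕ+ => (‖η j‖ * (j : ℝ) ^ q) ^ (2 : ℝ) := by
    refine Summable.congr h' fun j => ?_
    rw [wterm_eq]; norm_cast
  obtain ⟨h1, h2⟩ := Real.Lp_add_le_tsum_of_nonneg (p := 2) (by norm_num)
    (fun j => by positivity) (fun j => by positivity) hf hg
  have hle : ∀ j : ℕ+, ‖(ξ + η) j‖ ^ 2 * (j : ℝ) ^ (2 * q)
      ≤ (‖ξ j‖ * (j : ℝ) ^ q + ‖η j‖ * (j : ℝ) ^ q) ^ (2 : ℝ) := fun j => by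
    rw [wterm_eq, Real.rpow_two, ← add_mul]
    have := norm_add_le (ξ j) (η j)
    simp only [Pi.add_apply]
    gcongr
  have hs : WSum q (ξ + η) := Summable.of_nonneg_of_le (wterm_nonneg q _) hle h1
  refine ⟨hs, ?_⟩
  simp only [← Real.sqrt_eq_rpow] at h2
  refine le_trans (Real.sqrt_le_sqrt (Summable.tsum_le_tsum hle hs h1)) (h2.trans (le_of_eq ?_))
  simp only [wnorm, wterm_eq, Real.rpow_two]

theorem WSum.add {q : ℤ} {ξ η : ℕ+ → ℂ} (h : WSum q ξ) (h' : WSum q η) : WSum q (ξ + η) :=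
  (h.add_aux h').1

theorem wnorm_add_le {q : ℤ} {ξ η : ℕ+ → ℂ} (h : WSum q ξ) (h' : WSum q η) :
    wnorm q (ξ + η) ≤ wnorm q ξ + wnorm q η := (h.add_aux h').2

theorem wterm_mono {q r : ℤ} (hqr : q ≤ r) (ξ : ℕ+ → ℂ) (j : ℕ+) :
    ‖ξ j‖ ^ 2 * (j : ℝ) ^ (2 * q) ≤ ‖ξ j‖ ^ 2 * (j : ℝ) ^ (2 * r) := by
  gcongr
  exact one_le_pnat j

theorem WSum.mono {q r : ℤ} (hqr : q ≤ r) {ξ : ℕ+ → ℂ} (h : WSum r ξ) : WSum q ξ :=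
  Summable.of_nonneg_of_le (wterm_nonneg q _) (wterm_mono hqr ξ) h

theorem WSum.norm_le {q : ℤ} {ξ : ℕ+ → ℂ} (h : WSum q ξ) (j : ℕ+) :
    ‖ξ j‖ * (j : ℝ) ^ q ≤ wnorm q ξ := by
  apply Real.le_sqrt_of_sq_le
  rw [← wterm_eq]
  exact Summable.le_tsum h j fun i _ => wterm_nonneg q ξ i

theorem WSum.mul {q : ℤ} {ξ η : ℕ+ → ℂ} (h : WSum q ξ) (h' : WSum 0 η) : WSum q (ξ * η) := by
  refine Summable.of_nonneg_of_le (wterm_nonneg q _) (fun j => ?_)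
    (Summable.mul_left (wnorm 0 η ^ 2) h)
  have := h'.norm_le j
  rw [zpow_zero, mul_one] at this
  simp only [Pi.mul_apply, norm_mul, mul_pow]
  have h1 : ‖η j‖ ^ 2 ≤ wnorm 0 η ^ 2 := by gcongr
  have h2 := wterm_nonneg q ξ j
  nlinarith

theorem wterm_star (q : ℤ) (ξ : ℕ+ → ℂ) (j : ℕ+) :
    ‖(star ξ) j‖ ^ 2 * (j : ℝ) ^ (2 * q) = ‖ξ j‖ ^ 2 * (j : ℝ) ^ (2 * q) := by
  simp

theorem WSum.star {q : ℤ} {ξ : ℕ+ → ℂ} (h : WSum q ξ) : WSum q (star ξ) :=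
  Summable.congr h fun j => (wterm_star q ξ j).symm

/-- The Cauchy–Schwarz inequality for the pairing. -/
theorem pair_bound {q r : ℤ} (hqr : q + r = 0) {ξ η : ℕ+ → ℂ} (h : WSum q ξ) (h' : WSum r η) :
    (Summable fun j : ℕ+ => ξ j * conj (η j)) ∧ ‖pair ξ η‖ ≤ wnorm q ξ * wnorm r η := by
  have hf : Summable fun j : ℕ+ => (‖ξ j‖ * (j : ℝ) ^ q) ^ (2 : ℝ) := by
    refine Summable.congr h fun j => ?_
    rw [wterm_eq]; norm_cast
  have hg : Summable fun j : ℕ+ => (‖η j‖ * (j : ℝ) ^ r) ^ (2 : ℝ) := by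
    refine Summable.congr h' fun j => ?_
    rw [wterm_eq]; norm_cast
  obtain ⟨h1, h2⟩ := Real.summable_and_inner_le_Lp_mul_Lq_tsum_of_nonneg
    (Real.holderConjugate_iff.2 ⟨by norm_num, by norm_num⟩ : Real.HolderConjugate 2 2)
    (fun j => by positivity) (fun j => by positivity) hf hg
  have heq : ∀ j : ℕ+, ‖ξ j‖ * (j : ℝ) ^ q * (‖η j‖ * (j : ℝ) ^ r) = ‖ξ j * conj (η j)‖ := by
    intro j
    have : (j : ℝ) ^ q * (j : ℝ) ^ r = 1 := by
      rw [← zpow_add₀ (pnat_pos j).ne', hqr, zpow_zero]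
    rw [norm_mul, RCLike.norm_conj]
    linear_combination ‖ξ j‖ * ‖η j‖ * this
  simp only [heq] at h1 h2
  refine ⟨h1.of_norm, (norm_tsum_le_tsum_norm h1).trans (h2.trans (le_of_eq ?_))⟩
  simp only [wnorm, wterm_eq, Real.rpow_two, ← Real.sqrt_eq_rpow]

theorem pair_conj (ξ η : ℕ+ → ℂ) : conj (pair ξ η) = pair η ξ := by
  rw [pair, Complex.conj_tsum, pair]
  refine tsum_congr fun j => ?_
  rw [map_mul, Complex.conj_conj, mul_comm]

/-! ### The Fréchet `*`-algebra `s` of rapidly decreasing sequences -/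

/-- Rapidly decreasing sequences, with pointwise operations and conjugation. -/
def rapidSubalgebra : NonUnitalStarSubalgebra ℂ (ℕ+ → ℂ) where
  carrier := {ξ | ∀ q : ℕ, WSum q ξ}
  add_mem' h h' q := (h q).add (h' q)
  zero_mem' q := wsum_zero q
  mul_mem' h h' q := (h q).mul (by simpa using h' 0)
  smul_mem' c _ h q := (h q).smul c
  star_mem' h q := (h q).star

/-- The space `s`. It is a type of its own so that it does not inherit the product topology. -/
def RapidSeq : Type := rapidSubalgebra

instance : NonUnitalCommRing RapidSeq := inferInstanceAs (NonUnitalCommRing rapidSubalgebra)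

instance : StarRing RapidSeq := inferInstanceAs (StarRing rapidSubalgebra)

instance : Module ℂ RapidSeq := inferInstanceAs (Module ℂ rapidSubalgebra)

instance : IsScalarTower ℂ RapidSeq RapidSeq :=
  inferInstanceAs (IsScalarTower ℂ rapidSubalgebra rapidSubalgebra)

instance : SMulCommClass ℂ RapidSeq RapidSeq :=
  inferInstanceAs (SMulCommClass ℂ rapidSubalgebra rapidSubalgebra)

instance : StarModule ℂ RapidSeq := inferInstanceAs (StarModule ℂ rapidSubalgebra)

instance : FunLike RapidSeq ℕ+ ℂ where
  coe ξ := Subtype.val (p := (· ∈ rapidSubalgebra)) ξ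
  coe_injective := Subtype.val_injective

namespace RapidSeq

theorem ext {ξ η : RapidSeq} (h : ∀ j, ξ j = η j) : ξ = η := DFunLike.ext _ _ h

theorem wsum (ξ : RapidSeq) (q : ℕ) : WSum q ξ := ξ.2 q

theorem wsum_neg (ξ : RapidSeq) (q : ℕ) : WSum (-(q : ℤ)) ξ := (ξ.2 0).mono (by simp)

theorem coe_add (ξ η : RapidSeq) : ⇑(ξ + η) = ⇑ξ + ⇑η := rfl

theorem coe_smul (c : ℂ) (ξ : RapidSeq) : ⇑(c • ξ) = c • ⇑ξ := rfl

theorem coe_mul (ξ η : RapidSeq) : ⇑(ξ * η) = ⇑ξ * ⇑η := rfl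

theorem coe_star (ξ : RapidSeq) : ⇑(star ξ) = star ⇑ξ := rfl

/-- The norms `|ξ|_q = (∑_j |ξ_j|² j^{2q})^{1/2}`, `q = 0, 1, 2, …`. -/
def norms : SeminormFamily ℂ RapidSeq ℕ := fun q =>
  Seminorm.of (fun ξ => wnorm q ξ) (fun ξ η => wnorm_add_le (ξ.wsum q) (η.wsum q))
    (fun c ξ => wnorm_smul q c ξ)

/-- The topology of `s` is given by the norms `|·|_q`. -/
instance : TopologicalSpace RapidSeq := norms.moduleFilterBasis.topology

theorem withSeminorms : WithSeminorms norms := ⟨rfl⟩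

instance : IsTopologicalAddGroup RapidSeq := withSeminorms.topologicalAddGroup

instance : ContinuousSMul ℂ RapidSeq := withSeminorms.continuousSMul

end RapidSeq

theorem wsum_single (q : ℤ) (j : ℕ+) : WSum q (Pi.single j 1) := by
  refine summable_of_ne_finset_zero (s := {j}) fun i hi => ?_
  have : i ≠ j := by simpa using hi
  simp [this]

theorem wnorm_single (q : ℤ) (j : ℕ+) : wnorm q (Pi.single j 1) = (j : ℝ) ^ q := by
  rw [wnorm, tsum_eq_single j fun i hi => by simp [hi], wterm_eq]
  simp only [Pi.single_eq_same, norm_one, one_mul]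
  exact Real.sqrt_sq (zpow_nonneg (pnat_pos j).le q)

/-- The unit sequence `e_j ∈ s`. -/
def RapidSeq.unit (j : ℕ+) : RapidSeq := ⟨Pi.single j 1, fun q => wsum_single q j⟩

/-! ### The space `s'` of slowly increasing sequences -/

/-- Slowly increasing sequences. -/
def slowSubmodule : Submodule ℂ (ℕ+ → ℂ) where
  carrier := {η | ∃ q : ℕ, WSum (-(q : ℤ)) η}
  add_mem' := by
    rintro ξ η ⟨q, hq⟩ ⟨r, hr⟩
    refine ⟨max q r, (hq.mono ?_).add (hr.mono ?_)⟩ <;> simp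
  zero_mem' := ⟨0, wsum_zero _⟩
  smul_mem' := by
    rintro c ξ ⟨q, hq⟩
    exact ⟨q, hq.smul c⟩

/-- The space `s'`; its functionals on `s` are `ξ ↦ ⟨ξ, η⟩`. -/
def SlowSeq : Type := slowSubmodule

instance : AddCommGroup SlowSeq := inferInstanceAs (AddCommGroup slowSubmodule)

instance : Module ℂ SlowSeq := inferInstanceAs (Module ℂ slowSubmodule)

instance : FunLike SlowSeq ℕ+ ℂ where
  coe η := Subtype.val (p := (· ∈ slowSubmodule)) η
  coe_injective := Subtype.val_injective

namespace SlowSeq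

theorem ext {ξ η : SlowSeq} (h : ∀ j, ξ j = η j) : ξ = η := DFunLike.ext _ _ h

theorem exists_wsum (η : SlowSeq) : ∃ q : ℕ, WSum (-(q : ℤ)) η := η.2

theorem coe_add (ξ η : SlowSeq) : ⇑(ξ + η) = ⇑ξ + ⇑η := rfl

theorem coe_smul (c : ℂ) (ξ : SlowSeq) : ⇑(c • ξ) = c • ⇑ξ := rfl

/-- The seminorms on `s'` whose restriction to every step
`{η : |η|'_q = (∑_j |η_j|² j^{-2q})^{1/2} < ∞}` is continuous for the norm `|·|'_q`. -/
def IsStepBounded (p : Seminorm ℂ SlowSeq) : Prop :=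
  ∀ q : ℕ, ∃ C : ℝ, ∀ η : SlowSeq, WSum (-(q : ℤ)) η → p η ≤ C * wnorm (-(q : ℤ)) η

def stepSeminorms : SeminormFamily ℂ SlowSeq {p : Seminorm ℂ SlowSeq // IsStepBounded p} :=
  fun p => p.1

instance : Nonempty {p : Seminorm ℂ SlowSeq // IsStepBounded p} :=
  ⟨⟨0, fun _ => ⟨0, fun η _ => by simp⟩⟩⟩

/-- The (locally convex) inductive limit topology of the steps: the finest locally convex
topology for which the inclusions of all steps are continuous. -/
instance : TopologicalSpace SlowSeq := stepSeminorms.moduleFilterBasis.topology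

theorem withSeminorms : WithSeminorms stepSeminorms := ⟨rfl⟩

instance : IsTopologicalAddGroup SlowSeq := withSeminorms.topologicalAddGroup

instance : ContinuousSMul ℂ SlowSeq := withSeminorms.continuousSMul

/-- The unit sequence as an element of `s'`. -/
def unit (j : ℕ+) : SlowSeq := ⟨Pi.single j 1, 0, wsum_single _ j⟩

theorem IsStepBounded.of_le {p p' : Seminorm ℂ SlowSeq} (h : IsStepBounded p) (hle : p' ≤ p) :
    IsStepBounded p' := fun q => by
  obtain ⟨C, hC⟩ := h q
  exact ⟨C, fun η hη => (hle η).trans (hC η hη)⟩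

theorem isStepBounded_of_continuous {p : Seminorm ℂ SlowSeq} (hp : Continuous p) :
    IsStepBounded p := by
  obtain ⟨s, C, -, hC⟩ := Seminorm.bound_of_continuous withSeminorms p hp
  refine IsStepBounded.of_le ?_ hC
  clear hC
  have hs : IsStepBounded (s.sup stepSeminorms) := by
    classical
    induction s using Finset.induction_on with
    | empty => exact fun _ => ⟨0, fun η _ => by simp⟩
    | insert a s _ ih =>
      intro q
      obtain ⟨C₁, h₁⟩ := a.2 q
      obtain ⟨C₂, h₂⟩ := ih q
      refine ⟨max C₁ C₂, fun η hη => ?_⟩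
      rw [Finset.sup_insert, Seminorm.sup_apply]
      have := wnorm_nonneg (-(q : ℤ)) η
      refine max_le ((h₁ η hη).trans ?_) ((h₂ η hη).trans ?_)
      · gcongr; exact le_max_left _ _
      · gcongr; exact le_max_right _ _
  intro q
  obtain ⟨C', h'⟩ := hs q
  refine ⟨C * C', fun η hη => ?_⟩
  rw [_root_.smul_apply, NNReal.smul_def, smul_eq_mul, mul_assoc]
  gcongr
  exact h' η hη

end SlowSeq

/-! ### The algebra `L(s', s)` -/

/-- `L(s', s)`: the continuous linear maps from `s'` to `s`. Mathlib equips it with the topology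
of uniform convergence on bounded subsets of `s'`. -/
abbrev Op : Type := SlowSeq →L[ℂ] RapidSeq

theorem Op.bound (x : Op) (q r : ℕ) :
    ∃ C : ℝ, ∀ η : SlowSeq, WSum (-(r : ℤ)) η → wnorm q (x η) ≤ C * wnorm (-(r : ℤ)) η :=
  SlowSeq.isStepBounded_of_continuous
    (p := (RapidSeq.norms q).comp (x : SlowSeq →ₗ[ℂ] RapidSeq))
    ((RapidSeq.withSeminorms.continuous_seminorm q).comp x.continuous) r

/-- A linear map that is bounded from every step of `s'` to `s` is continuous. -/
def Op.mk (x : SlowSeq →ₗ[ℂ] RapidSeq)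
    (hx : ∀ q r : ℕ, ∃ C : ℝ, ∀ η : SlowSeq, WSum (-(r : ℤ)) η →
      wnorm q (x η) ≤ C * wnorm (-(r : ℤ)) η) : Op where
  toLinearMap := x
  cont := WithSeminorms.continuous_of_continuous_comp RapidSeq.withSeminorms x fun q =>
    SlowSeq.withSeminorms.continuous_seminorm ⟨(RapidSeq.norms q).comp x, hx q⟩

/-- The embedding `j : s → s'`. -/
def incl : RapidSeq →L[ℂ] SlowSeq where
  toFun ξ := ⟨ξ, 0, ξ.wsum_neg 0⟩
  map_add' _ _ := rfl
  map_smul' _ _ := rfl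
  cont := by
    let j : RapidSeq →ₗ[ℂ] SlowSeq :=
      { toFun := fun ξ => ⟨ξ, 0, ξ.wsum_neg 0⟩, map_add' := fun _ _ => rfl,
        map_smul' := fun _ _ => rfl }
    refine WithSeminorms.continuous_of_continuous_comp SlowSeq.withSeminorms j fun p => ?_
    obtain ⟨C, hC⟩ := p.2 0
    refine Seminorm.continuous_of_le (q := (Real.toNNReal C) • RapidSeq.norms 0)
      ((RapidSeq.withSeminorms.continuous_seminorm 0).const_smul _) fun ξ => ?_
    refine (hC (j ξ) (ξ.wsum_neg 0)).trans ?_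
    rw [_root_.smul_apply, NNReal.smul_def, smul_eq_mul]
    have : wnorm (-((0 : ℕ) : ℤ)) (j ξ) = RapidSeq.norms 0 ξ := by
      simp only [Nat.cast_zero, neg_zero]; rfl
    rw [this]
    gcongr
    exact Real.le_coe_toNNReal C

/-- The multiplication `xy = x ∘ j ∘ y`. -/
instance : Mul Op := ⟨fun x y => x.comp (incl.comp y)⟩

theorem Op.mul_apply (x y : Op) (η : SlowSeq) : (x * y) η = x (incl (y η)) := rfl

instance : NonUnitalRing Op where
  left_distrib x y z := by ext1 η; simp [Op.mul_apply]
  right_distrib x y z := by ext1 η; simp [Op.mul_apply]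
  zero_mul x := by ext1 η; simp [Op.mul_apply]
  mul_zero x := by ext1 η; simp [Op.mul_apply]
  mul_assoc x y z := rfl

instance : IsScalarTower ℂ Op Op := ⟨fun c x y => by ext1 η; simp [Op.mul_apply]⟩

instance : SMulCommClass ℂ Op Op := ⟨fun c x y => by ext1 η; simp [Op.mul_apply]⟩

/-- A pairing of `s'` with a fixed element of `s` is given by an absolutely convergent series. -/
theorem summable_pair (η : SlowSeq) (ξ : RapidSeq) : Summable fun j => η j * conj (ξ j) := by
  obtain ⟨q, hq⟩ := η.exists_wsum
  exact (pair_bound (by simp) hq (ξ.wsum q)).1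

theorem pair_bound_slow {q : ℕ} {η : SlowSeq} (hη : WSum (-(q : ℤ)) η) (ξ : RapidSeq) :
    ‖pair η ξ‖ ≤ wnorm (-(q : ℤ)) η * wnorm q ξ :=
  (pair_bound (by simp) hη (ξ.wsum q)).2

theorem pair_add (η η' : SlowSeq) (ξ : RapidSeq) :
    pair ⇑(η + η') ξ = pair η ξ + pair η' ξ := by
  rw [pair, pair, pair, ← (summable_pair η ξ).tsum_add (summable_pair η' ξ)]
  exact tsum_congr fun j => by simp [SlowSeq.coe_add, add_mul]

theorem pair_smul (c : ℂ) (η : SlowSeq) (ξ : RapidSeq) :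
    pair ⇑(c • η) ξ = c * pair η ξ := by
  rw [pair, pair, ← tsum_mul_left]
  exact tsum_congr fun j => by simp [SlowSeq.coe_smul, mul_assoc]

/-- The functional `⟨·, ξ⟩` on `s'`. -/
def pairL (ξ : RapidSeq) : SlowSeq →ₗ[ℂ] ℂ where
  toFun η := pair η ξ
  map_add' η η' := pair_add η η' ξ
  map_smul' c η := pair_smul c η ξ

/-- The operator `⟨·, f⟩ g`. -/
def rankOne (f g : RapidSeq) : Op :=
  Op.mk ((pairL f).smulRight g) fun q r => ⟨wnorm r f * wnorm q g, fun η hη => by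
    have h1 : wnorm q ⇑(((pairL f).smulRight g) η) = ‖pair η f‖ * wnorm q g :=
      wnorm_smul q (pair η f) g
    rw [h1]
    have := mul_le_mul_of_nonneg_right (pair_bound_slow hη f) (wnorm_nonneg q g)
    linarith⟩

theorem rankOne_apply (f g : RapidSeq) (η : SlowSeq) : rankOne f g η = pair η f • g := rfl

/-! ### The involution of `L(s', s)` -/

theorem adjoint_aux (x : Op) (q r : ℕ) : ∃ C : ℝ, ∀ η : SlowSeq, WSum (-(r : ℤ)) η →
    WSum q (fun j => pair η (x (SlowSeq.unit j))) ∧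
    wnorm q (fun j => pair η (x (SlowSeq.unit j))) ≤ C * wnorm (-(r : ℤ)) η := by
  obtain ⟨C, hC⟩ := x.bound r (q + 1)
  have hS : Summable fun j : ℕ+ => ((j : ℝ) ^ 2)⁻¹ := by
    have := (Real.summable_nat_pow_inv (p := 2)).2 (by norm_num)
    exact this.comp_injective PNat.coe_injective
  have key : ∀ η : SlowSeq, WSum (-(r : ℤ)) η → ∀ j : ℕ+,
      ‖pair η (x (SlowSeq.unit j))‖ ^ 2 * (j : ℝ) ^ (2 * (q : ℤ))
        ≤ (C * wnorm (-(r : ℤ)) η) ^ 2 * ((j : ℝ) ^ 2)⁻¹ := by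
    intro η hη j
    have h1 := pair_bound_slow hη (x (SlowSeq.unit j))
    have h2 := hC (SlowSeq.unit j) (wsum_single _ j)
    have h3 : wnorm (-((q + 1 : ℕ) : ℤ)) (SlowSeq.unit j) = (j : ℝ) ^ (-((q + 1 : ℕ) : ℤ)) :=
      wnorm_single _ j
    rw [h3] at h2
    have h4 : ‖pair η (x (SlowSeq.unit j))‖
        ≤ C * wnorm (-(r : ℤ)) η * (j : ℝ) ^ (-((q + 1 : ℕ) : ℤ)) :=
      h1.trans ((mul_le_mul_of_nonneg_left h2 (wnorm_nonneg _ _)).trans (le_of_eq (by ring)))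
    have hj := pnat_pos j
    have h5 : ‖pair η (x (SlowSeq.unit j))‖ * (j : ℝ) ^ (q : ℤ)
        ≤ C * wnorm (-(r : ℤ)) η * (j : ℝ)⁻¹ := by
      refine (mul_le_mul_of_nonneg_right h4 (zpow_nonneg hj.le _)).trans (le_of_eq ?_)
      rw [mul_assoc, ← zpow_add₀ hj.ne', ← zpow_neg_one]
      congr 2
      push_cast; ring
    rw [wterm_eq q (fun j => pair η (x (SlowSeq.unit j))) j, ← inv_pow, ← mul_pow]
    gcongr
  refine ⟨|C| * √(∑' j : ℕ+, ((j : ℝ) ^ 2)⁻¹), fun η hη => ?_⟩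
  have hs : WSum q (fun j => pair η (x (SlowSeq.unit j))) :=
    Summable.of_nonneg_of_le (wterm_nonneg q _) (key η hη) (hS.mul_left _)
  refine ⟨hs, (Real.sqrt_le_sqrt (Summable.tsum_le_tsum (key η hη) hs (hS.mul_left _))).trans
    (le_of_eq ?_)⟩
  rw [tsum_mul_left, Real.sqrt_mul (sq_nonneg _), Real.sqrt_sq_eq_abs, abs_mul,
    abs_of_nonneg (wnorm_nonneg _ _)]
  ring

theorem adjoint_mem (x : Op) (η : SlowSeq) (q : ℕ) :
    WSum q (fun j => pair η (x (SlowSeq.unit j))) := by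
  obtain ⟨r, hr⟩ := η.exists_wsum
  obtain ⟨C, hC⟩ := adjoint_aux x q r
  exact (hC η hr).1

/-- The adjoint `x^*`, with coordinates `(x^* η)_j = ⟨η, x e_j⟩`. It is the hermitian adjoint
of `x` on `ℓ₂`, see `pair_apply`. -/
def Op.adjoint (x : Op) : Op :=
  Op.mk
    { toFun := fun η => ⟨fun j => pair η (x (SlowSeq.unit j)), adjoint_mem x η⟩
      map_add' := fun η η' => RapidSeq.ext fun j => pair_add η η' (x (SlowSeq.unit j))
      map_smul' := fun c η => RapidSeq.ext fun j => pair_smul c η (x (SlowSeq.unit j)) }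
    fun q r => by
      obtain ⟨C, hC⟩ := adjoint_aux x q r
      exact ⟨C, fun η hη => (hC η hη).2⟩

instance : Star Op := ⟨Op.adjoint⟩

theorem Op.star_apply (x : Op) (η : SlowSeq) (j : ℕ+) :
    (star x) η j = pair η (x (SlowSeq.unit j)) := rfl

/-- A linear functional that is bounded on every step of `s'` is given by its values on the
unit sequences. -/
theorem hasSum_functional (φ : SlowSeq →ₗ[ℂ] ℂ)
    (hφ : ∀ r : ℕ, ∃ C : ℝ, ∀ η : SlowSeq, WSum (-(r : ℤ)) η →
      ‖φ η‖ ≤ C * wnorm (-(r : ℤ)) η) (η : SlowSeq) :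
    HasSum (fun j => η j * φ (SlowSeq.unit j)) (φ η) := by
  obtain ⟨r, hr⟩ := η.exists_wsum
  obtain ⟨C, hC⟩ := hφ r
  rw [HasSum, SummationFilter.unconditional_filter]
  rw [tendsto_iff_norm_sub_tendsto_zero]
  have hval : ∀ s : Finset ℕ+, ∀ i : ℕ+, (η - ∑ j ∈ s, η j • SlowSeq.unit j : SlowSeq) i
      = if i ∈ s then 0 else η i := by
    intro s i
    have h1 : (η - ∑ j ∈ s, η j • SlowSeq.unit j : SlowSeq) i
        = η i - (∑ j ∈ s, η j • SlowSeq.unit j : SlowSeq) i := rfl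
    have h2 : (∑ j ∈ s, η j • SlowSeq.unit j : SlowSeq) i
        = ∑ j ∈ s, η j * (Pi.single j 1 : ℕ+ → ℂ) i := by
      have := congrFun (map_sum slowSubmodule.subtype (fun j => (η j • SlowSeq.unit j : SlowSeq)) s)
        i
      rw [Finset.sum_apply] at this
      exact this
    rw [h1, h2]
    by_cases hi : i ∈ s <;> simp [Pi.single_apply, hi]
  have hterm : ∀ s : Finset ℕ+, ∀ i : ℕ+,
      ‖(η - ∑ j ∈ s, η j • SlowSeq.unit j : SlowSeq) i‖ ^ 2 * (i : ℝ) ^ (2 * (-(r : ℤ)))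
      = if i ∈ s then 0 else ‖η i‖ ^ 2 * (i : ℝ) ^ (2 * (-(r : ℤ))) := by
    intro s i
    rw [hval]; split_ifs <;> simp
  have hws : ∀ s : Finset ℕ+, WSum (-(r : ℤ)) (η - ∑ j ∈ s, η j • SlowSeq.unit j : SlowSeq) := by
    intro s
    refine Summable.of_nonneg_of_le (wterm_nonneg _ _) (fun i => ?_) hr
    rw [hterm]; split_ifs
    · exact wterm_nonneg _ _ _
    · exact le_rfl
  have hnorm : Filter.Tendsto
      (fun s : Finset ℕ+ => wnorm (-(r : ℤ)) (η - ∑ j ∈ s, η j • SlowSeq.unit j : SlowSeq))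
      Filter.atTop (nhds 0) := by
    have h0 := tendsto_tsum_compl_atTop_zero
      (fun i : ℕ+ => ‖η i‖ ^ 2 * (i : ℝ) ^ (2 * (-(r : ℤ))))
    have h1 := (Real.continuous_sqrt.tendsto 0).comp h0
    rw [Real.sqrt_zero] at h1
    refine h1.congr fun s => ?_
    simp only [Function.comp_apply, wnorm]
    congr 1
    rw [tsum_congr (hterm s)]
    refine (tsum_subtype {i : ℕ+ | i ∉ s} fun i : ℕ+ =>
      ‖η i‖ ^ 2 * (i : ℝ) ^ (2 * (-(r : ℤ)))).trans ?_
    exact tsum_congr fun i => by by_cases hi : i ∈ s <;> simp [Set.indicator, hi]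
  refine squeeze_zero (fun _ => norm_nonneg _) (fun s => ?_)
    (by simpa using hnorm.const_mul C)
  have : φ η - ∑ j ∈ s, η j * φ (SlowSeq.unit j) = φ (η - ∑ j ∈ s, η j • SlowSeq.unit j) := by
    rw [map_sub, map_sum]; simp
  rw [norm_sub_rev, this]
  exact hC _ (hws s)

/-- `⟨x ξ, η⟩ = ⟨ξ, x^* η⟩`. -/
theorem pair_apply (x : Op) (ξ η : SlowSeq) :
    pair (x ξ) η = pair ξ (star x η) := by
  obtain ⟨t, ht⟩ := η.exists_wsum
  have hp : ∀ ζ : RapidSeq, pair ζ η = conj (pair η ζ) := fun ζ => (pair_conj _ _).symm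
  have hφ := hasSum_functional
    { toFun := fun ζ => pair (x ζ) η
      map_add' := fun ζ ζ' => by
        have h := pair_bound (q := t) (r := -t) (by simp) ((x ζ).wsum t) ht
        have h' := pair_bound (q := t) (r := -t) (by simp) ((x ζ').wsum t) ht
        rw [map_add, pair, pair, pair, ← h.1.tsum_add h'.1]
        exact tsum_congr fun j => by simp [RapidSeq.coe_add, add_mul]
      map_smul' := fun c ζ => by
        rw [map_smul, pair, pair, smul_eq_mul, RingHom.id_apply, ← tsum_mul_left]
        exact tsum_congr fun j => by simp [RapidSeq.coe_smul, mul_assoc] }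
    (fun r => by
      obtain ⟨C, hC⟩ := x.bound t r
      refine ⟨wnorm (-(t : ℤ)) η * C, fun ζ hζ => ?_⟩
      refine (pair_bound (q := t) (r := -t) (by simp) ((x ζ).wsum t) ht).2.trans ?_
      rw [mul_comm, mul_assoc]
      exact mul_le_mul_of_nonneg_left (hC ζ hζ) (wnorm_nonneg _ _)) ξ
  refine hφ.tsum_eq.symm.trans ?_
  rw [pair]
  refine tsum_congr fun j => ?_
  rw [Op.star_apply, pair_conj]
  rfl

theorem pair_single (ξ : ℕ+ → ℂ) (j : ℕ+) : pair ξ (Pi.single j 1) = ξ j := by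
  rw [pair, tsum_eq_single j fun i hi => by simp [hi]]
  simp

theorem Op.ext' {x y : Op} (h : ∀ η j, x η j = y η j) : x = y :=
  ContinuousLinearMap.ext fun η => RapidSeq.ext (h η)

instance : StarRing Op where
  star_involutive x := Op.ext' fun η j => by
    rw [Op.star_apply, ← pair_apply]
    exact pair_single _ j
  star_mul x y := Op.ext' fun η j => by
    rw [Op.star_apply, Op.mul_apply, Op.mul_apply, Op.star_apply, ← pair_conj, pair_apply,
      pair_conj]
    rfl
  star_add x y := Op.ext' fun η j => by
    have h := summable_pair η (x (SlowSeq.unit j))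
    have h' := summable_pair η (y (SlowSeq.unit j))
    have h3 : (star x + star y) η j = star x η j + star y η j := rfl
    rw [h3, Op.star_apply, Op.star_apply, Op.star_apply, pair, pair, pair, ← h.tsum_add h']
    exact tsum_congr fun i => by simp [RapidSeq.coe_add, mul_add]

instance : StarModule ℂ Op where
  star_smul c x := Op.ext' fun η j => by
    have h3 : (star c • star x) η j = star c * star x η j := rfl
    rw [h3, Op.star_apply, Op.star_apply, pair, pair, ← tsum_mul_left]
    refine tsum_congr fun i => ?_
    simp only [_root_.smul_apply, RapidSeq.coe_smul, Pi.smul_apply, smul_eq_mul,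
      map_mul, starRingEnd_apply]
    ring

/-! ### Generated closed subalgebras, isomorphisms, and the vectors of the example -/

/-- `alg(Z)`: the smallest closed `*`-subalgebra of `L(s', s)` that contains `Z`. -/
def alg (Z : Set Op) : NonUnitalStarSubalgebra ℂ Op :=
  sInf {E | IsClosed (E : Set Op) ∧ Z ⊆ E}

/-- Isomorphism as Fréchet `*`-algebras: a bijective linear multiplicative `*`-preserving map,
continuous with its inverse. -/
def IsoFrechetStarAlg (A B : Type*) [NonUnitalRing A] [NonUnitalRing B] [Module ℂ A] [Module ℂ B]
    [Star A] [Star B] [TopologicalSpace A] [TopologicalSpace B] : Prop :=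
  ∃ Φ : A ≃⋆ₐ[ℂ] B, Continuous Φ ∧ Continuous Φ.symm

/-- Isomorphism merely as complex algebras: a bijective linear multiplicative map. -/
def IsoAlg (A B : Type*) [NonUnitalRing A] [NonUnitalRing B] [Module ℂ A] [Module ℂ B] : Prop :=
  ∃ Φ : A ≃ₗ[ℂ] B, ∀ x y, Φ (x * y) = Φ x * Φ y

/-- The towers `N_{k,1} = m_k`, `N_{k,j+1} = m_k ^ N_{k,j}`, with `m_k` the `k`-th prime number.
Here `k` and `j` are counted from `0`. -/
def tower (k : ℕ) : ℕ → ℕ+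
  | 0 => ⟨Nat.nth Nat.Prime k, (Nat.prime_nth_prime k).pos⟩
  | j + 1 => ⟨Nat.nth Nat.Prime k, (Nat.prime_nth_prime k).pos⟩ ^ (tower k j : ℕ)

/-- The unnormalized coefficients `(∏_{i<j} N_{k,i}) / N_{k,j}^{j-1}` (`j` counted from `1`;
here `j` is counted from `0`, so that the exponent is `j`). -/
def rawCoeff (k j : ℕ) : ℝ :=
  (∏ i ∈ Finset.range j, (tower k i : ℝ)) / (tower k j : ℝ) ^ j

/-- The normalized coefficients `a_{k,j} = c_k · rawCoeff k j`, with
`c_k = (∑_j (rawCoeff k j)²)^{-1/2}`. -/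
def coeff (k j : ℕ) : ℝ := (√(∑' i, rawCoeff k i ^ 2))⁻¹ * rawCoeff k j

end

end SmoothOp

open SmoothOp

/-! Each `⟨·, f_k⟩ f_k` is an idempotent, and these idempotents are mutually orthogonal. An algebra
isomorphism onto a closed subalgebra of `s` therefore maps them to mutually orthogonal nonzero
idempotents of `s`, i.e. to indicator functions `χ_k` of disjoint finite sets; put `m_k` for the
largest element of the `k`-th set, so that `|χ_k|_t ≤ m_k ^ (t + 1)`. If `x` is sent to `ξ`, the
eigenvalues `λ_k` of `x` at `f_k` are the values of `ξ` on these sets. Hence `λ_k m_k` is bounded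
whenever `∑ λ_k ⟨·, f_k⟩ f_k` converges, in particular if `∑ |λ_k| |f_k|_q² < ∞` for all `q`,
which forces `m_k = O(|f_k|_p²)` for some `p`. Conversely `λ_k |f_k|_q` is bounded for every `q`
whenever `∑ λ_k χ_k` converges in `s`, which together with the first estimate gives
`|f_k|_q = O(|f_k|_p ^ r)`, with `p` fixed and `r` depending on `q`. For the vectors of the theorem
`|f_k|_q` is of the order of `N_{k,1} ⋯ N_{k,q}`. Hence `|f_k|_p` is at most of order
`N_{k,p+1} ^ p`, whereas `|f_k|_{p+2}` is at least of order `2 ^ N_{k,p+1}`, a contradiction. -/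

namespace SmoothOp

open Filter Topology Asymptotics
open scoped ComplexConjugate

/-! ### Convergence of series in `s` -/

section WeightedNorms

variable {ι : Type*} {q : ℤ}

theorem WSum.sum {ξ : ι → ℕ+ → ℂ} (s : Finset ι) (hξ : ∀ i, WSum q (ξ i)) :
    WSum q (∑ i ∈ s, ξ i) :=
  Finset.sum_induction ξ (WSum q) (fun _ _ => WSum.add) (wsum_zero q) fun i _ => hξ i

theorem wnorm_sum_le {ξ : ι → ℕ+ → ℂ} (s : Finset ι) (hξ : ∀ i, WSum q (ξ i)) :
    wnorm q (∑ i ∈ s, ξ i) ≤ ∑ i ∈ s, wnorm q (ξ i) :=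
  Finset.le_sum_of_subadditive_on_pred (wnorm q) (WSum q) (wnorm_zero q).le
    (fun _ _ => wnorm_add_le) (fun _ _ => WSum.add) ξ fun i _ => hξ i

theorem wsum_and_wnorm_le_of_tendsto {l : Filter ι} [l.NeBot] {ξ : ι → ℕ+ → ℂ} {η : ℕ+ → ℂ}
    {C : ℝ} (hξ : ∀ i, WSum q (ξ i)) (hC : ∀ i, wnorm q (ξ i) ≤ C) (hlim : Tendsto ξ l (𝓝 η)) :
    WSum q η ∧ wnorm q η ≤ C := by
  have hC0 : 0 ≤ C := (wnorm_nonneg q _).trans (hC l.nonempty_of_neBot.some)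
  have hfin (J : Finset ℕ+) : ∑ j ∈ J, ‖η j‖ ^ 2 * (j : ℝ) ^ (2 * q) ≤ C ^ 2 := by
    refine le_of_tendsto' (tendsto_finsetSum J fun j _ =>
      ((tendsto_pi_nhds.1 hlim j).norm.pow 2).mul_const ((j : ℝ) ^ (2 * q))) fun i => ?_
    calc ∑ j ∈ J, ‖ξ i j‖ ^ 2 * (j : ℝ) ^ (2 * q)
        ≤ ∑' j : ℕ+, ‖ξ i j‖ ^ 2 * (j : ℝ) ^ (2 * q) :=
          (hξ i).sum_le_tsum J fun j _ => wterm_nonneg q (ξ i) j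
      _ = wnorm q (ξ i) ^ 2 := (Real.sq_sqrt (tsum_nonneg (wterm_nonneg q (ξ i)))).symm
      _ ≤ C ^ 2 := pow_le_pow_left₀ (wnorm_nonneg q _) (hC i) 2
  exact ⟨summable_of_sum_le (wterm_nonneg q η) hfin,
    Real.sqrt_le_iff.2 ⟨hC0, Real.tsum_le_of_sum_le (wterm_nonneg q η) hfin⟩⟩

theorem wsum_and_wnorm_le_tsum {ξ : ι → ℕ+ → ℂ} {η : ℕ+ → ℂ} (hξ : ∀ i, WSum q (ξ i))
    (hsum : Summable fun i => wnorm q (ξ i)) (hη : HasSum ξ η) :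
    WSum q η ∧ wnorm q η ≤ ∑' i, wnorm q (ξ i) :=
  wsum_and_wnorm_le_of_tendsto (fun s => WSum.sum s hξ)
    (fun s => (wnorm_sum_le s hξ).trans (hsum.sum_le_tsum s fun _ _ => wnorm_nonneg q _)) hη

theorem wnorm_mono {p q : ℤ} (hpq : p ≤ q) {ξ : ℕ+ → ℂ} (hξ : WSum q ξ) :
    wnorm p ξ ≤ wnorm q ξ :=
  Real.sqrt_le_sqrt (Summable.tsum_le_tsum (wterm_mono hpq ξ) (hξ.mono hpq) hξ)

theorem wsum_and_wnorm_le_of_norm_le {ξ η : ℕ+ → ℂ} (h : ∀ j, ‖ξ j‖ ≤ ‖η j‖) (hη : WSum q η) :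
    WSum q ξ ∧ wnorm q ξ ≤ wnorm q η := by
  have hterm (j : ℕ+) : ‖ξ j‖ ^ 2 * (j : ℝ) ^ (2 * q) ≤ ‖η j‖ ^ 2 * (j : ℝ) ^ (2 * q) := by
    gcongr
    exact h j
  have hξ : WSum q ξ := .of_nonneg_of_le (wterm_nonneg q ξ) hterm hη
  exact ⟨hξ, Real.sqrt_le_sqrt (hξ.tsum_le_tsum hterm hη)⟩

theorem wnorm_mul_le {ξ η : ℕ+ → ℂ} (hξ : WSum q ξ) (hη : WSum 0 η) :
    wnorm q (ξ * η) ≤ wnorm q ξ * wnorm 0 η := by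
  have hle (j : ℕ+) : ‖(ξ * η) j‖ ≤ ‖((wnorm 0 η : ℂ) • ξ) j‖ := by
    have hηj : ‖η j‖ ≤ wnorm 0 η := by simpa using hη.norm_le j
    rw [Pi.mul_apply, Pi.smul_apply, smul_eq_mul, norm_mul, norm_mul, mul_comm,
      Complex.norm_of_nonneg (wnorm_nonneg 0 η)]
    gcongr
  have := (wsum_and_wnorm_le_of_norm_le hle (hξ.smul _)).2
  rwa [wnorm_smul, Complex.norm_of_nonneg (wnorm_nonneg 0 η),
    mul_comm (wnorm 0 η)] at this

end WeightedNorms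

namespace RapidSeq

variable {ι : Type*}

theorem wnorm_mono (ξ : RapidSeq) {p q : ℕ} (hpq : p ≤ q) : wnorm p ξ ≤ wnorm q ξ :=
  SmoothOp.wnorm_mono (Nat.cast_le.2 hpq) (ξ.wsum q)

theorem norm_apply_mul_pow_le (ξ : RapidSeq) (q : ℕ) (j : ℕ+) :
    ‖ξ j‖ * (j : ℝ) ^ q ≤ wnorm q ξ := by
  simpa using (ξ.wsum q).norm_le j

theorem norm_apply_le (ξ : RapidSeq) (j : ℕ+) : ‖ξ j‖ ≤ wnorm 0 ξ := by
  simpa using ξ.norm_apply_mul_pow_le 0 j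

theorem continuous_apply (j : ℕ+) : Continuous fun ξ : RapidSeq => ξ j := by
  let evalL : RapidSeq →ₗ[ℂ] ℂ :=
    { toFun := fun ξ => ξ j, map_add' := fun _ _ => rfl, map_smul' := fun _ _ => rfl }
  exact WithSeminorms.continuous_of_continuous_comp (norm_withSeminorms ℂ ℂ) evalL fun _ =>
    Seminorm.continuous_of_le (withSeminorms.continuous_seminorm 0) fun ξ => ξ.norm_apply_le j

/-- The inclusion of `s` into the space of all complex sequences, which carries the topology of
coordinatewise convergence. -/
def coeL : RapidSeq →L[ℂ] ℕ+ → ℂ where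
  toFun ξ := ξ
  map_add' := coe_add
  map_smul' := coe_smul
  cont := continuous_pi continuous_apply

theorem coe_sum (s : Finset ι) (ξ : ι → RapidSeq) : ⇑(∑ i ∈ s, ξ i) = ∑ i ∈ s, ⇑(ξ i) :=
  map_sum coeL ξ s

instance : T2Space RapidSeq :=
  T2Space.of_injective_continuous (f := coeL) DFunLike.coe_injective coeL.continuous

instance : SeparatelyContinuousMul RapidSeq := by
  have hmul (ξ : RapidSeq) : Continuous (ξ * ·) := by
    refine WithSeminorms.continuous_of_continuous_comp withSeminorms (LinearMap.mulLeft ℂ ξ)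
      fun q => ?_
    let C : NNReal := ⟨wnorm q ξ, wnorm_nonneg q ξ⟩
    exact Seminorm.continuous_of_le (q := C • norms 0)
      ((withSeminorms.continuous_seminorm 0).const_smul C)
      fun η => wnorm_mul_le (ξ.wsum q) (η.wsum 0)
  exact ⟨hmul _, fun {ξ} => by simpa only [mul_comm] using hmul ξ⟩

theorem wnorm_sub_sum_le {q : ℕ} {ξ : ι → RapidSeq} {η : RapidSeq}
    (hξ : Summable fun i => wnorm q (ξ i)) (hη : HasSum (fun i => ⇑(ξ i)) ⇑η) (s : Finset ι) :
    wnorm q ⇑(η - ∑ i ∈ s, ξ i) ≤ ∑' i : {i // i ∉ s}, wnorm q (ξ i) := by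
  have hcompl : HasSum (fun i : {i // i ∉ s} => ⇑(ξ i)) ⇑(η - ∑ i ∈ s, ξ i) := by
    refine (Finset.hasSum_compl_iff (f := fun i => ⇑(ξ i)) s).2 ?_
    rwa [← coe_sum, ← coe_add, sub_add_cancel]
  exact (wsum_and_wnorm_le_tsum (fun i : {i // i ∉ s} => (ξ i).wsum q)
    (hξ.comp_injective Subtype.val_injective) hcompl).2

theorem hasSum_of_hasSum_coe {ξ : ι → RapidSeq} {η : RapidSeq}
    (hξ : ∀ q : ℕ, Summable fun i => wnorm q (ξ i)) (hη : HasSum (fun i => ⇑(ξ i)) ⇑η) :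
    HasSum ξ η := by
  refine (withSeminorms.tendsto_nhds _ _).2 fun q ε hε => ?_
  filter_upwards [(tendsto_tsum_compl_atTop_zero fun i => wnorm q (ξ i)).eventually_lt_const hε]
    with s hs
  rw [map_sub_rev]
  exact (wnorm_sub_sum_le (hξ q) hη s).trans_lt hs

theorem summable_of_summable_wnorm {ξ : ι → RapidSeq}
    (hξ : ∀ q : ℕ, Summable fun i => wnorm q (ξ i)) : Summable ξ := by
  obtain ⟨η, hη⟩ : Summable fun i => ⇑(ξ i) := Pi.summable.2 fun j =>
    .of_norm_bounded (hξ 0) fun i => (ξ i).norm_apply_le j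
  exact ⟨⟨η, fun q => (wsum_and_wnorm_le_tsum (fun i => (ξ i).wsum q) (hξ q) hη).1⟩,
    hasSum_of_hasSum_coe hξ hη⟩

theorem wnorm_tsum_le {ξ : ι → RapidSeq} (hξ : ∀ q : ℕ, Summable fun i => wnorm q (ξ i)) (q : ℕ) :
    wnorm q ⇑(∑' i, ξ i) ≤ ∑' i, wnorm q (ξ i) :=
  (wsum_and_wnorm_le_tsum (fun i => (ξ i).wsum q) (hξ q)
    ((summable_of_summable_wnorm hξ).hasSum.mapL coeL)).2

end RapidSeq

/-! ### Bounded subsets of `s'` and convergence in `L(s', s)` -/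

namespace SlowSeq

theorem exists_forall_le_of_isVonNBounded {ι : Type*} [Nonempty ι] {p : ι → Seminorm ℂ SlowSeq}
    (hp : ∀ r : ℕ, ∃ C : ℝ, ∀ i (η : SlowSeq), WSum (-(r : ℤ)) η →
      p i η ≤ C * wnorm (-(r : ℤ)) η)
    {B : Set SlowSeq} (hB : Bornology.IsVonNBounded ℂ B) :
    ∃ M : ℝ, ∀ i, ∀ η ∈ B, p i η ≤ M := by
  have hbdd : BddAbove (Set.range p) := Seminorm.bddAbove_range_iff.2 fun η => by
    obtain ⟨r, hr⟩ := η.exists_wsum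
    obtain ⟨C, hC⟩ := hp r
    exact ⟨_, Set.forall_mem_range.2 fun i => hC i η hr⟩
  have hstep : IsStepBounded (⨆ i, p i) := fun r => by
    obtain ⟨C, hC⟩ := hp r
    refine ⟨C, fun η hη => ?_⟩
    rw [Seminorm.iSup_apply hbdd]
    exact ciSup_le fun i => hC i η hη
  obtain ⟨M, -, hM⟩ := withSeminorms.isVonNBounded_iff_seminorm_bounded.1 hB ⟨_, hstep⟩
  exact ⟨M, fun i η hη => (le_ciSup hbdd i η).trans (hM η hη).le⟩

/-- If the conclusion fails at `η n ∈ B` in the coordinate `j n` for every `n`, then the seminorms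
`|η (j n)| / (j n) ^ n` are equicontinuous on the steps, but not uniformly bounded on `B`. -/
theorem exists_norm_apply_le_of_isVonNBounded {B : Set SlowSeq}
    (hB : Bornology.IsVonNBounded ℂ B) :
    ∃ n : ℕ, ∀ η ∈ B, ∀ j : ℕ+, ‖η j‖ ≤ n * (j : ℝ) ^ n := by
  by_contra! hcon
  choose η hηB j hη using hcon
  let coord (i : ℕ+) : SlowSeq →ₗ[ℂ] ℂ :=
    { toFun := fun η => η i, map_add' := fun _ _ => rfl, map_smul' := fun _ _ => rfl }
  let w (n : ℕ) : NNReal := ((j n : NNReal) ^ n)⁻¹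
  let p (n : ℕ) : Seminorm ℂ SlowSeq := w n • (normSeminorm ℂ ℂ).comp (coord (j n))
  have hp (r : ℕ) : ∃ C : ℝ, ∀ n (η : SlowSeq), WSum (-(r : ℤ)) η →
      p n η ≤ C * wnorm (-(r : ℤ)) η := by
    obtain ⟨C, hC⟩ : BddAbove (Set.range fun n => (j n : ℝ) ^ r / (j n : ℝ) ^ n) := by
      refine (isBoundedUnder_of_eventually_le (a := 1) ?_).bddAbove_range
      filter_upwards [eventually_ge_atTop r] with n hn
      exact div_le_one_of_le₀ (pow_le_pow_right₀ (one_le_pnat _) hn) (by positivity)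
    refine ⟨C, fun n η hη => ?_⟩
    have hcoord : ‖η (j n)‖ ≤ (j n : ℝ) ^ r * wnorm (-(r : ℤ)) η := by
      have := hη.norm_le (j n)
      rwa [zpow_neg, zpow_natCast, mul_inv_le_iff₀' (pow_pos (pnat_pos (j n)) r)] at this
    calc ((j n : ℝ) ^ n)⁻¹ * ‖η (j n)‖
        ≤ ((j n : ℝ) ^ n)⁻¹ * ((j n : ℝ) ^ r * wnorm (-(r : ℤ)) η) := by gcongr
      _ = (j n : ℝ) ^ r / (j n : ℝ) ^ n * wnorm (-(r : ℤ)) η := by ring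
      _ ≤ C * wnorm (-(r : ℤ)) η :=
        mul_le_mul_of_nonneg_right (hC ⟨n, rfl⟩) (wnorm_nonneg _ _)
  obtain ⟨M, hM⟩ := exists_forall_le_of_isVonNBounded hp hB
  obtain ⟨n, hn⟩ := exists_nat_gt M
  have hle : ((j n : ℝ) ^ n)⁻¹ * ‖η n (j n)‖ ≤ M := hM n _ (hηB n)
  have hpos := pow_pos (pnat_pos (j n)) n
  rw [inv_mul_le_iff₀ hpos] at hle
  nlinarith [hη n]

theorem exists_wnorm_le_of_isVonNBounded {B : Set SlowSeq} (hB : Bornology.IsVonNBounded ℂ B) :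
    ∃ (r : ℕ) (M : ℝ), ∀ η ∈ B, WSum (-(r : ℤ)) η ∧ wnorm (-(r : ℤ)) η ≤ M := by
  obtain ⟨n, hn⟩ := exists_norm_apply_le_of_isVonNBounded hB
  have hpow : WSum (-((n + 1 : ℕ) : ℤ)) fun j => (n : ℂ) * (j : ℂ) ^ n := by
    have hsq : Summable fun j : ℕ+ => (n : ℝ) ^ 2 * ((j : ℝ) ^ 2)⁻¹ :=
      ((Real.summable_nat_pow_inv.2 one_lt_two).comp_injective PNat.coe_injective).mul_left _
    refine hsq.congr fun j => ?_
    have := (pnat_pos j).ne'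
    have hexp : (2 : ℤ) * -((n + 1 : ℕ) : ℤ) = -((2 * n + 2 : ℕ) : ℤ) := by push_cast; ring
    simp only [norm_mul, norm_pow, Complex.norm_natCast, hexp, zpow_neg, zpow_natCast]
    field_simp
    ring
  refine ⟨n + 1, _, fun η hη => wsum_and_wnorm_le_of_norm_le (fun j => ?_) hpow⟩
  simpa using hn η hη j

end SlowSeq

namespace Op

variable {ι : Type*}

theorem tendsto_of_wnorm_sub_apply_le {l : Filter ι} {x : ι → Op} {y : Op}
    (h : ∀ q r : ℕ, ∃ C : ι → ℝ, Tendsto C l (𝓝 0) ∧ ∀ i (η : SlowSeq), WSum (-(r : ℤ)) η →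
      wnorm q ⇑(y η - x i η) ≤ C i * wnorm (-(r : ℤ)) η) :
    Tendsto x l (𝓝 y) := by
  rw [← tendsto_sub_nhds_zero_iff, ContinuousLinearMap.nhds_zero_eq_of_basis
    RapidSeq.withSeminorms.hasBasis_zero_ball]
  simp only [tendsto_iInf, tendsto_principal]
  rintro B hB ⟨I, ε⟩ hε
  obtain ⟨r, M, hM⟩ := SlowSeq.exists_wnorm_le_of_isVonNBounded hB
  have hlt (q : ℕ) : ∀ᶠ i in l, ∀ η ∈ B, wnorm q ⇑(y η - x i η) < ε := by
    obtain ⟨C, hC, hle⟩ := h q r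
    have hCM : Tendsto (fun i => |C i| * M) l (𝓝 0) := by simpa using hC.abs.mul_const M
    filter_upwards [hCM.eventually_lt_const hε] with i hi η hη
    calc wnorm q ⇑(y η - x i η) ≤ C i * wnorm (-(r : ℤ)) η := hle i η (hM η hη).1
      _ ≤ |C i| * M := mul_le_mul (le_abs_self _) (hM η hη).2 (wnorm_nonneg _ _) (abs_nonneg _)
      _ < ε := hi
  filter_upwards [I.eventually_all.2 fun q _ => hlt q] with i hi η hη
  rw [Seminorm.mem_ball_zero]
  refine Seminorm.finset_sup_apply_lt hε fun q hq => ?_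
  rw [_root_.sub_apply, map_sub_rev]
  exact hi q hq η hη

theorem summable_of_summable_bound {x : ι → Op}
    (h : ∀ q r : ℕ, ∃ b : ι → ℝ, Summable b ∧ ∀ i (η : SlowSeq), WSum (-(r : ℤ)) η →
      wnorm q (x i η) ≤ b i * wnorm (-(r : ℤ)) η) :
    Summable x := by
  have hsum (η : SlowSeq) (q : ℕ) : Summable fun i => wnorm q (x i η) := by
    obtain ⟨r, hr⟩ := η.exists_wsum
    obtain ⟨b, hb, hle⟩ := h q r
    exact .of_nonneg_of_le (fun i => wnorm_nonneg _ _) (fun i => hle i η hr) (hb.mul_right _)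
  have hx (η : SlowSeq) : Summable fun i => x i η :=
    RapidSeq.summable_of_summable_wnorm (hsum η)
  let T : SlowSeq →ₗ[ℂ] RapidSeq :=
    { toFun := fun η => ∑' i, x i η
      map_add' := fun η η' => by simp only [map_add, (hx η).tsum_add (hx η')]
      map_smul' := fun c η => by simp only [map_smul, RingHom.id_apply, (hx η).tsum_const_smul] }
  have hT (q r : ℕ) : ∃ b : ι → ℝ, Summable b ∧ ∀ (s : Finset ι) (η : SlowSeq),
      WSum (-(r : ℤ)) η → wnorm q ⇑(T η - ∑ i ∈ s, x i η) ≤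
        (∑' i : {i // i ∉ s}, b i) * wnorm (-(r : ℤ)) η := by
    obtain ⟨b, hb, hle⟩ := h q r
    refine ⟨b, hb, fun s η hη => ?_⟩
    calc wnorm q ⇑(T η - ∑ i ∈ s, x i η) ≤ ∑' i : {i // i ∉ s}, wnorm q (x i η) :=
          RapidSeq.wnorm_sub_sum_le (hsum η q) ((hx η).hasSum.mapL RapidSeq.coeL) s
      _ ≤ ∑' i : {i // i ∉ s}, b i * wnorm (-(r : ℤ)) η :=
          ((hsum η q).comp_injective Subtype.val_injective).tsum_le_tsum (fun i => hle i η hη)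
            ((hb.mul_right _).comp_injective Subtype.val_injective)
      _ = (∑' i : {i // i ∉ s}, b i) * wnorm (-(r : ℤ)) η := tsum_mul_right
  let y : Op := Op.mk T fun q r => by
    obtain ⟨b, -, hb⟩ := hT q r
    exact ⟨_, fun η hη => by simpa using hb ∅ η hη⟩
  refine ⟨y, tendsto_of_wnorm_sub_apply_le fun q r => ?_⟩
  obtain ⟨b, -, hb⟩ := hT q r
  refine ⟨fun s => ∑' i : {i // i ∉ s}, b i, tendsto_tsum_compl_atTop_zero b, fun s η hη => ?_⟩
  rw [sum_apply]
  exact hb s η hη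

end Op

/-! ### Algebras generated by projections -/

theorem mul_eq_smul_of_hasSum_smul {R A ι : Type*} [NonUnitalNonAssocRing A] [SMulZeroClass R A]
    [IsScalarTower R A A] [TopologicalSpace A] [T2Space A] [SeparatelyContinuousMul A]
    {e : ι → A} (hidem : ∀ i, IsIdempotentElem (e i)) (horth : Pairwise fun i j => e i * e j = 0)
    {c : ι → R} {x : A} (hx : HasSum (fun i => c i • e i) x) (k : ι) : x * e k = c k • e k := by
  have hmul : HasSum (fun i => c i • e i * e k) (x * e k) :=
    hx.map (AddMonoidHom.mulRight (e k)) (continuous_mul_const (e k))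
  refine hmul.unique ?_
  convert hasSum_single k fun i hi => ?_ using 1
  · rw [smul_mul_assoc, hidem k]
  · rw [smul_mul_assoc, horth hi, smul_zero]

instance : SeparatelyContinuousMul Op :=
  ⟨fun {z} => (ContinuousLinearMap.postcomp SlowSeq (z.comp incl)).continuous,
    fun {z} => (ContinuousLinearMap.precomp RapidSeq (incl.comp z)).continuous⟩

theorem isClosed_alg (Z : Set Op) : IsClosed (alg Z : Set Op) := by
  rw [alg, NonUnitalStarAlgebra.coe_sInf]
  exact isClosed_biInter fun E hE => hE.1

theorem subset_alg (Z : Set Op) : Z ⊆ alg Z := by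
  rw [alg, NonUnitalStarAlgebra.coe_sInf]
  exact Set.subset_iInter₂ fun E hE => hE.2

theorem alg_le {Z : Set Op} {E : NonUnitalStarSubalgebra ℂ Op} (hE : IsClosed (E : Set Op))
    (hZ : Z ⊆ E) : alg Z ≤ E := sInf_le ⟨hE, hZ⟩

theorem isClosed_centralizer (Z : Set Op) :
    IsClosed (NonUnitalStarSubalgebra.centralizer ℂ Z : Set Op) := by
  rw [NonUnitalStarSubalgebra.coe_centralizer]
  exact Set.isClosed_centralizer _

theorem alg_le_centralizer_centralizer (Z : Set Op) :
    alg Z ≤ NonUnitalStarSubalgebra.centralizer ℂ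
      (NonUnitalStarSubalgebra.centralizer ℂ Z : Set Op) := by
  refine alg_le (isClosed_centralizer _) fun z hz => ?_
  rw [SetLike.mem_coe, NonUnitalStarSubalgebra.mem_centralizer_iff]
  have hcomm {x : Op} (hx : x ∈ NonUnitalStarSubalgebra.centralizer ℂ Z) : x * z = z * x :=
    ((NonUnitalStarSubalgebra.mem_centralizer_iff ℂ).1 hx z hz).1.symm
  exact fun x hx => ⟨hcomm hx, hcomm (star_mem hx)⟩

theorem alg_commute {Z : Set Op} (hstar : ∀ z ∈ Z, IsSelfAdjoint z)
    (hcomm : ∀ z ∈ Z, ∀ w ∈ Z, z * w = w * z) :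
    ∀ x ∈ alg Z, ∀ y ∈ alg Z, x * y = y * x := by
  have hle : alg Z ≤ NonUnitalStarSubalgebra.centralizer ℂ Z :=
    alg_le (isClosed_centralizer Z) fun z hz => by
      rw [SetLike.mem_coe, NonUnitalStarSubalgebra.mem_centralizer_iff]
      intro w hw
      rw [hstar w hw]
      exact ⟨hcomm w hw z hz, hcomm w hw z hz⟩
  exact fun x hx y hy => ((NonUnitalStarSubalgebra.mem_centralizer_iff ℂ).1
    (alg_le_centralizer_centralizer Z hy) x (hle hx)).1

theorem rankOne_mul_rankOne (f g : RapidSeq) :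
    rankOne f f * rankOne g g = pair g f • rankOne g f := by
  ext1 η
  rw [Op.mul_apply, rankOne_apply, rankOne_apply, map_smul, pair_smul, mul_comm,
    mul_smul]
  rfl

theorem isSelfAdjoint_rankOne (f : RapidSeq) : IsSelfAdjoint (rankOne f f) :=
  Op.ext' fun η j => by
    have hunit : pair (SlowSeq.unit j) f = conj (f j) := by
      rw [← pair_conj]
      exact congrArg conj (pair_single f j)
    rw [Op.star_apply, rankOne_apply, rankOne_apply, RapidSeq.coe_smul, RapidSeq.coe_smul, hunit,
      Pi.smul_apply, smul_eq_mul, pair, pair, ← tsum_mul_right]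
    refine tsum_congr fun i => ?_
    simp only [Pi.smul_apply, smul_eq_mul, map_mul, Complex.conj_conj]
    ring

theorem pair_self (ξ : ℕ+ → ℂ) : pair ξ ξ = (wnorm 0 ξ ^ 2 : ℝ) := by
  rw [wnorm, Real.sq_sqrt (tsum_nonneg (wterm_nonneg 0 ξ)), pair, Complex.ofReal_tsum]
  refine tsum_congr fun j => ?_
  rw [Complex.mul_conj, Complex.normSq_eq_norm_sq, mul_zero, zpow_zero, mul_one]

/-- Orthonormality of a family in `s` with respect to the inner product of `ℓ₂`. -/
def IsOrthonormal {ι : Type*} (f : ι → RapidSeq) : Prop :=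
  (∀ i, pair (f i) (f i) = 1) ∧ Pairwise fun i j => pair (f i) (f j) = 0

/-- The closed `*`-subalgebra of `L(s', s)` generated by the operators `⟨·, f i⟩ f i`, which are
the orthogonal projections onto the lines `ℂ f i` if the `f i` are orthonormal. -/
noncomputable def projAlg {ι : Type*} (f : ι → RapidSeq) : NonUnitalStarSubalgebra ℂ Op :=
  alg (Set.range fun i => rankOne (f i) (f i))

/-- The generator `⟨·, f i⟩ f i` as an element of `projAlg f`. -/
noncomputable def projAlg.proj {ι : Type*} (f : ι → RapidSeq) (i : ι) : projAlg f :=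
  ⟨rankOne (f i) (f i), subset_alg _ ⟨i, rfl⟩⟩

namespace IsOrthonormal

variable {ι κ : Type*} {f : ι → RapidSeq}

theorem comp_injective (hf : IsOrthonormal f) {φ : κ → ι} (hφ : Function.Injective φ) :
    IsOrthonormal (f ∘ φ) :=
  ⟨fun k => hf.1 (φ k), hf.2.comp_of_injective hφ⟩

theorem wnorm_zero (hf : IsOrthonormal f) (i : ι) : wnorm 0 (f i) = 1 := by
  have h : wnorm 0 (f i) ^ 2 = 1 := by
    exact_mod_cast (pair_self (f i)).symm.trans (hf.1 i)
  exact (pow_eq_one_iff_of_nonneg (wnorm_nonneg 0 _) two_ne_zero).1 h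

theorem one_le_wnorm (hf : IsOrthonormal f) (q : ℕ) (i : ι) : 1 ≤ wnorm q (f i) :=
  (hf.wnorm_zero i).symm.trans_le ((f i).wnorm_mono (Nat.zero_le q))

theorem isIdempotentElem_rankOne (hf : IsOrthonormal f) (i : ι) :
    IsIdempotentElem (rankOne (f i) (f i)) := by
  rw [IsIdempotentElem, rankOne_mul_rankOne, hf.1, one_smul]

theorem rankOne_mul_rankOne_of_ne (hf : IsOrthonormal f) {i j : ι} (hij : i ≠ j) :
    rankOne (f i) (f i) * rankOne (f j) (f j) = 0 := by
  rw [rankOne_mul_rankOne, hf.2 hij.symm, zero_smul]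

theorem rankOne_apply_incl (hf : IsOrthonormal f) (i : ι) :
    rankOne (f i) (f i) (incl (f i)) = f i := by
  rw [rankOne_apply]
  exact (congrArg (· • f i) (hf.1 i)).trans (one_smul ℂ (f i))

theorem projAlg_commute (hf : IsOrthonormal f) :
    ∀ x ∈ projAlg f, ∀ y ∈ projAlg f, x * y = y * x := by
  refine alg_commute (Set.forall_mem_range.2 fun i => isSelfAdjoint_rankOne (f i)) ?_
  rintro _ ⟨i, rfl⟩ _ ⟨j, rfl⟩
  rcases eq_or_ne i j with rfl | hij
  · rfl
  · exact (hf.rankOne_mul_rankOne_of_ne hij).trans (hf.rankOne_mul_rankOne_of_ne hij.symm).symm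

theorem exists_norm_mul_wnorm_le (hf : IsOrthonormal f) (x : projAlg f) (q : ℕ) :
    ∃ C : ℝ, ∀ i (c : ℂ), x * projAlg.proj f i = c • projAlg.proj f i →
      ‖c‖ * wnorm q (f i) ≤ C := by
  obtain ⟨C, hC⟩ := (x : Op).bound q 0
  refine ⟨C, fun i c h => ?_⟩
  have heig : (x : Op) (incl (f i)) = c • f i := by
    have := DFunLike.congr_fun (congrArg Subtype.val h) (incl (f i))
    change (x : Op) (incl (rankOne (f i) (f i) (incl (f i)))) =
      c • rankOne (f i) (f i) (incl (f i)) at this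
    rwa [hf.rankOne_apply_incl] at this
  have hnorm : wnorm (-((0 : ℕ) : ℤ)) (incl (f i)) = 1 := hf.wnorm_zero i
  have := hC (incl (f i)) ((f i).wsum_neg 0)
  rwa [heig, RapidSeq.coe_smul, wnorm_smul, hnorm, mul_one] at this

end IsOrthonormal

theorem wnorm_rankOne_le {f : RapidSeq} {q r : ℕ} {η : SlowSeq} (hη : WSum (-(r : ℤ)) η) :
    wnorm q (rankOne f f η) ≤ wnorm (max q r : ℕ) f ^ 2 * wnorm (-(r : ℤ)) η := by
  rw [rankOne_apply, RapidSeq.coe_smul, wnorm_smul]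
  have hη0 := wnorm_nonneg (-(r : ℤ)) η
  have hpair : ‖pair η f‖ ≤ wnorm (-(r : ℤ)) η * wnorm (max q r : ℕ) f :=
    (pair_bound_slow hη f).trans (by gcongr; exact f.wnorm_mono (le_max_right q r))
  calc ‖pair η f‖ * wnorm q f
      ≤ (wnorm (-(r : ℤ)) η * wnorm (max q r : ℕ) f) * wnorm (max q r : ℕ) f :=
        mul_le_mul hpair (f.wnorm_mono (le_max_left q r)) (wnorm_nonneg _ _)
          ((norm_nonneg _).trans hpair)
    _ = wnorm (max q r : ℕ) f ^ 2 * wnorm (-(r : ℤ)) η := by ring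

theorem summable_smul_rankOne {ι : Type*} {f : ι → RapidSeq} {c : ι → ℂ}
    (h : ∀ q : ℕ, Summable fun i => ‖c i‖ * wnorm q (f i) ^ 2) :
    Summable fun i => c i • rankOne (f i) (f i) := by
  refine Op.summable_of_summable_bound fun q r => ⟨_, h (max q r), fun i η hη => ?_⟩
  rw [_root_.smul_apply, RapidSeq.coe_smul, wnorm_smul, mul_assoc]
  gcongr
  exact wnorm_rankOne_le hη

theorem IsOrthonormal.exists_mul_proj_eq_smul {ι κ : Type*} {f : ι → RapidSeq}
    (hf : IsOrthonormal f) {φ : κ → ι} (hφ : Function.Injective φ) {c : κ → ℂ}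
    (h : ∀ q : ℕ, Summable fun k => ‖c k‖ * wnorm q (f (φ k)) ^ 2) :
    ∃ x : projAlg f, ∀ k, x * projAlg.proj f (φ k) = c k • projAlg.proj f (φ k) := by
  obtain ⟨x, hx⟩ := summable_smul_rankOne (f := f ∘ φ) h
  have hmem : x ∈ projAlg f := (isClosed_alg _).mem_of_tendsto hx <| .of_forall fun s =>
    sum_mem fun k _ => SMulMemClass.smul_mem _ (projAlg.proj f (φ k)).2
  have hfφ := hf.comp_injective hφ
  exact ⟨⟨x, hmem⟩, fun k => Subtype.ext <|
    mul_eq_smul_of_hasSum_smul hfφ.isIdempotentElem_rankOne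
      (fun _ _ => hfφ.rankOne_mul_rankOne_of_ne) hx k⟩

/-! ### Isomorphisms onto subalgebras of `s` -/

theorem wnorm_le_pow_succ_of_support_le {ξ : ℕ+ → ℂ} {m : ℕ+} (hsupp : ∀ j, m < j → ξ j = 0)
    (hle : ∀ j, ‖ξ j‖ ≤ 1) (q : ℕ) : wnorm q ξ ≤ (m : ℝ) ^ (q + 1) := by
  have hdom (j : ℕ+) : ‖ξ j‖ ≤ ‖(∑ i ∈ Finset.Icc 1 m, Pi.single i (1 : ℂ) : ℕ+ → ℂ) j‖ := by
    rcases le_or_gt j m with hj | hj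
    · simpa [Finset.sum_apply, Pi.single_apply, hj] using hle j
    · simp [hsupp j hj]
  have hwsum (i : ℕ+) : WSum q (Pi.single i 1) := wsum_single q i
  calc wnorm q ξ
      ≤ wnorm q (∑ i ∈ Finset.Icc 1 m, Pi.single i (1 : ℂ)) :=
        (wsum_and_wnorm_le_of_norm_le hdom (WSum.sum _ hwsum)).2
    _ ≤ ∑ i ∈ Finset.Icc 1 m, wnorm q (Pi.single i 1) := wnorm_sum_le _ hwsum
    _ ≤ ∑ _i ∈ Finset.Icc 1 m, (m : ℝ) ^ q := Finset.sum_le_sum fun i hi => by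
        have him : (i : ℝ) ≤ m := by exact_mod_cast (Finset.mem_Icc.1 hi).2
        rw [wnorm_single, zpow_natCast]
        gcongr
    _ = (m : ℝ) ^ (q + 1) := by simp [pow_succ']

namespace RapidSeq

variable {e : RapidSeq}

theorem apply_eq_zero_or_one (he : IsIdempotentElem e) (j : ℕ+) : e j = 0 ∨ e j = 1 :=
  IsIdempotentElem.iff_eq_zero_or_one.1 (DFunLike.congr_fun he j)

theorem finite_setOf_apply_eq_one (ξ : RapidSeq) : {j | ξ j = 1}.Finite := by
  refine (Set.finite_Iic ⌈wnorm 1 ξ⌉₊.succPNat).subset fun j (hj : ξ j = 1) => ?_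
  have hle := ξ.norm_apply_mul_pow_le 1 j
  rw [hj, norm_one, one_mul, pow_one] at hle
  have hceil : (j : ℕ) ≤ ⌈wnorm 1 ξ⌉₊ := by exact_mod_cast hle.trans (Nat.le_ceil _)
  rw [Set.mem_Iic, ← PNat.coe_le_coe, Nat.succPNat_coe]
  exact hceil.trans (Nat.le_succ _)

theorem exists_apply_eq_one_and_wnorm_le_pow (he : IsIdempotentElem e) (h0 : e ≠ 0) :
    ∃ m : ℕ+, e m = 1 ∧ ∀ q : ℕ, wnorm q e ≤ (m : ℝ) ^ (q + 1) := by
  have hne : {j | e j = 1}.Nonempty := by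
    by_contra! hempty
    exact h0 <| RapidSeq.ext fun j =>
      (apply_eq_zero_or_one he j).resolve_right (Set.eq_empty_iff_forall_notMem.1 hempty j)
  obtain ⟨m, hm, hmax⟩ := Set.exists_max_image _ id e.finite_setOf_apply_eq_one hne
  refine ⟨m, hm, fun q => wnorm_le_pow_succ_of_support_le (fun j hj => ?_) (fun j => ?_) q⟩
  · exact (apply_eq_zero_or_one he j).resolve_right fun h => (hmax j h).not_gt hj
  · rcases apply_eq_zero_or_one he j with h | h <;> simp [h]

theorem norm_mul_pow_le_of_mul_eq_smul {ξ : RapidSeq} {c : ℂ} (h : ξ * e = c • e) {m : ℕ+}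
    (hm : e m = 1) (q : ℕ) : ‖c‖ * (m : ℝ) ^ q ≤ wnorm q ξ := by
  have hξ : ξ m * e m = c * e m := DFunLike.congr_fun h m
  rw [hm, mul_one, mul_one] at hξ
  exact hξ ▸ ξ.norm_apply_mul_pow_le q m

end RapidSeq

theorem exists_strictMono_of_not_isBigO {u : ℕ → ℕ → ℝ} {v : ℕ → ℝ} (hu : Monotone u)
    (hu0 : ∀ n k, 0 ≤ u n k) (hv0 : ∀ k, 0 ≤ v k) (h : ∀ n, ¬ v =O[atTop] u n) :
    ∃ φ : ℕ → ℕ, StrictMono φ ∧ ∃ c : ℕ → ℝ, (∀ n, 0 ≤ c n) ∧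
      (∀ n, Summable fun i => c i * u n (φ i)) ∧ Tendsto (fun i => c i * v (φ i)) atTop atTop := by
  have hfreq (n : ℕ) : ∃ᶠ k in atTop, (4 : ℝ) ^ n * u n k < v k := by
    by_contra hle
    refine h n (.of_bound (4 ^ n) ?_)
    filter_upwards [not_frequently.1 hle] with k hk
    rw [Real.norm_of_nonneg (hv0 k), Real.norm_of_nonneg (hu0 n k)]
    exact not_lt.1 hk
  obtain ⟨φ, hφ, hlt⟩ := extraction_forall_of_frequently hfreq
  have hpos (i : ℕ) : 0 < v (φ i) :=
    (mul_nonneg (by positivity) (hu0 i (φ i))).trans_lt (hlt i)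
  refine ⟨φ, hφ, fun i => 2 ^ i / v (φ i), fun i => by have := hpos i; positivity,
    fun n => ?_, ?_⟩
  · refine .of_norm_bounded_eventually_nat summable_geometric_two ?_
    filter_upwards [eventually_ge_atTop n] with i hi
    have := hpos i
    have := hu0 n (φ i)
    rw [Real.norm_of_nonneg (by positivity), div_mul_eq_mul_div, div_le_iff₀ (hpos i)]
    calc (2 : ℝ) ^ i * u n (φ i) ≤ 2 ^ i * u i (φ i) := by gcongr; exact hu hi _
      _ = (1 / 2) ^ i * (4 ^ i * u i (φ i)) := by
        rw [← mul_assoc, ← mul_pow]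
        norm_num
      _ ≤ (1 / 2) ^ i * v (φ i) := by gcongr; exact (hlt i).le
  · simpa only [div_mul_cancel₀ _ (hpos _).ne'] using
      tendsto_pow_atTop_atTop_of_one_lt (one_lt_two (α := ℝ))

section Isomorphism

variable {f : ℕ → RapidSeq} {F : NonUnitalStarSubalgebra ℂ RapidSeq} {Φ : projAlg f ≃ₗ[ℂ] F}

theorem map_mul_map_proj_iff (hΦ : ∀ x y, Φ (x * y) = Φ x * Φ y) {x : projAlg f} {k : ℕ} {c : ℂ} :
    Φ x * Φ (projAlg.proj f k) = c • Φ (projAlg.proj f k) ↔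
      x * projAlg.proj f k = c • projAlg.proj f k := by
  rw [← hΦ, ← map_smul, Φ.injective.eq_iff]

theorem isIdempotentElem_map_proj (hf : IsOrthonormal f) (hΦ : ∀ x y, Φ (x * y) = Φ x * Φ y)
    (k : ℕ) : IsIdempotentElem (Φ (projAlg.proj f k) : RapidSeq) := by
  have hproj : projAlg.proj f k * projAlg.proj f k = projAlg.proj f k :=
    Subtype.ext (hf.isIdempotentElem_rankOne k)
  exact congrArg Subtype.val ((hΦ _ _).symm.trans (congrArg Φ hproj))

theorem map_proj_mul_map_proj (hf : IsOrthonormal f) (hΦ : ∀ x y, Φ (x * y) = Φ x * Φ y)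
    {k l : ℕ} (hkl : k ≠ l) : (Φ (projAlg.proj f k) : RapidSeq) * Φ (projAlg.proj f l) = 0 := by
  have hproj : projAlg.proj f k * projAlg.proj f l = 0 :=
    Subtype.ext (hf.rankOne_mul_rankOne_of_ne hkl)
  exact congrArg Subtype.val
    ((hΦ _ _).symm.trans ((congrArg Φ hproj).trans (map_zero Φ)))

theorem map_proj_ne_zero (hf : IsOrthonormal f) (k : ℕ) :
    (Φ (projAlg.proj f k) : RapidSeq) ≠ 0 := by
  intro hzero
  have hproj : projAlg.proj f k = 0 := Φ.map_eq_zero_iff.1 (Subtype.ext hzero)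
  have hfk : f k = 0 := by
    rw [← hf.rankOne_apply_incl k, show rankOne (f k) (f k) = 0 from congrArg Subtype.val hproj]
    rfl
  have hnorm := hf.wnorm_zero k
  rw [hfk] at hnorm
  exact zero_ne_one ((map_zero (RapidSeq.norms 0)).symm.trans hnorm)

theorem exists_isBigO_wnorm_sq (hf : IsOrthonormal f) (hΦ : ∀ x y, Φ (x * y) = Φ x * Φ y)
    {m : ℕ → ℕ+} (hm : ∀ k, (Φ (projAlg.proj f k) : RapidSeq) (m k) = 1) :
    ∃ p : ℕ, (fun k => (m k : ℝ)) =O[atTop] fun k => wnorm p (f k) ^ 2 := by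
  by_contra! hcon
  obtain ⟨φ, hφ, c, hc0, hsum, htop⟩ := exists_strictMono_of_not_isBigO
    (u := fun p k => wnorm p (f k) ^ 2)
    (fun p q hpq k => by dsimp only; gcongr; exacts [wnorm_nonneg _ _, (f k).wnorm_mono hpq])
    (fun _ _ => sq_nonneg _) (fun k => (pnat_pos (m k)).le) hcon
  obtain ⟨x, hx⟩ := hf.exists_mul_proj_eq_smul hφ.injective (c := fun i => (c i : ℂ))
    fun q => by simpa only [Complex.norm_of_nonneg (hc0 _)] using hsum q
  obtain ⟨i, hi⟩ := (htop.eventually_gt_atTop (wnorm 1 (Φ x : RapidSeq))).exists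
  have heig : (Φ x : RapidSeq) * Φ (projAlg.proj f (φ i)) = (c i : ℂ) • Φ (projAlg.proj f (φ i)) :=
    congrArg Subtype.val ((map_mul_map_proj_iff hΦ).2 (hx i))
  have hle := RapidSeq.norm_mul_pow_le_of_mul_eq_smul heig (hm (φ i)) 1
  rw [Complex.norm_of_nonneg (hc0 i), pow_one] at hle
  exact hle.not_gt hi

theorem exists_isBigO_wnorm_pow (hf : IsOrthonormal f) (hΦ : ∀ x y, Φ (x * y) = Φ x * Φ y)
    (hF : IsClosed (F : Set RapidSeq)) {p : ℕ} {m : ℕ → ℕ+}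
    (hwnorm : ∀ k (q : ℕ), wnorm q (Φ (projAlg.proj f k) : RapidSeq) ≤ (m k : ℝ) ^ (q + 1))
    (hp : (fun k => (m k : ℝ)) =O[atTop] fun k => wnorm p (f k) ^ 2) (q : ℕ) :
    ∃ r : ℕ, (fun k => wnorm q (f k)) =O[atTop] fun k => wnorm p (f k) ^ r := by
  by_contra! hcon
  obtain ⟨φ, hφ, c, hc0, hsum, htop⟩ := exists_strictMono_of_not_isBigO
    (u := fun t k => (wnorm p (f k) ^ 2) ^ (t + 1))
    (fun s t hst k => pow_le_pow_right₀ (one_le_pow₀ (hf.one_le_wnorm p k)) (by gcongr))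
    (fun _ _ => by positivity) (fun k => wnorm_nonneg q (f k))
    (fun t => by simpa only [← pow_mul] using hcon _)
  have hsummable (t : ℕ) :
      Summable fun i => wnorm t ⇑((c i : ℂ) • (Φ (projAlg.proj f (φ i)) : RapidSeq)) := by
    have hO := (hp.pow (t + 1)).comp_tendsto hφ.tendsto_atTop
    refine summable_of_isBigO_nat (hsum t) (.trans (.of_bound 1 ?_) ((isBigO_refl c _).mul hO))
    refine .of_forall fun i => ?_
    rw [Real.norm_of_nonneg (wnorm_nonneg _ _), RapidSeq.coe_smul, wnorm_smul,
      Complex.norm_of_nonneg (hc0 i), one_mul]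
    exact (mul_le_mul_of_nonneg_left (hwnorm (φ i) t) (hc0 i)).trans (Real.le_norm_self _)
  obtain ⟨ξ, hξ⟩ := RapidSeq.summable_of_summable_wnorm hsummable
  have hξF : ξ ∈ F := hF.mem_of_tendsto hξ <| .of_forall fun s =>
    sum_mem fun k _ => SMulMemClass.smul_mem _ (Φ (projAlg.proj f (φ k))).2
  obtain ⟨x, hx⟩ := Φ.surjective ⟨ξ, hξF⟩
  obtain ⟨C, hC⟩ := hf.exists_norm_mul_wnorm_le x q
  obtain ⟨i, hi⟩ := (htop.eventually_gt_atTop C).exists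
  have heig : Φ x * Φ (projAlg.proj f (φ i)) = (c i : ℂ) • Φ (projAlg.proj f (φ i)) := by
    rw [hx]
    exact Subtype.ext <| mul_eq_smul_of_hasSum_smul (fun i => isIdempotentElem_map_proj hf hΦ (φ i))
      (fun _ _ hij => map_proj_mul_map_proj hf hΦ (hφ.injective.ne hij)) hξ i
  have hle := hC (φ i) (c i) ((map_mul_map_proj_iff hΦ).1 heig)
  rw [Complex.norm_of_nonneg (hc0 i)] at hle
  exact hle.not_gt hi

theorem exists_forall_exists_isBigO_wnorm_pow_of_isoAlg (hf : IsOrthonormal f)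
    (hF : IsClosed (F : Set RapidSeq)) (h : IsoAlg (projAlg f) F) :
    ∃ p : ℕ, ∀ q : ℕ, ∃ r : ℕ, (fun k => wnorm q (f k)) =O[atTop] fun k => wnorm p (f k) ^ r := by
  obtain ⟨Φ, hΦ⟩ := h
  choose m hm hwnorm using fun k => RapidSeq.exists_apply_eq_one_and_wnorm_le_pow
    (isIdempotentElem_map_proj hf hΦ k) (map_proj_ne_zero (Φ := Φ) hf k)
  obtain ⟨p, hp⟩ := exists_isBigO_wnorm_sq hf hΦ hm
  exact ⟨p, exists_isBigO_wnorm_pow hf hΦ hF hwnorm hp⟩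

end Isomorphism

/-! ### Towers of prime powers -/

section Tower

theorem tower_zero (k : ℕ) : (tower k 0 : ℕ) = Nat.nth Nat.Prime k := by
  simp [tower]

theorem tower_succ (k j : ℕ) : (tower k (j + 1) : ℕ) = Nat.nth Nat.Prime k ^ (tower k j : ℕ) :=
  PNat.pow_coe _ _

theorem two_pow_tower_le (k j : ℕ) : 2 ^ (tower k j : ℕ) ≤ (tower k (j + 1) : ℕ) := by
  rw [tower_succ]
  exact Nat.pow_le_pow_left (Nat.prime_nth_prime k).two_le _

theorem two_mul_tower_le_succ (k j : ℕ) : 2 * (tower k j : ℕ) ≤ tower k (j + 1) := by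
  refine le_trans ?_ (two_pow_tower_le k j)
  obtain ⟨n, hn⟩ := Nat.exists_eq_succ_of_ne_zero (tower k j).ne_zero
  rw [hn, pow_succ']
  exact Nat.mul_le_mul_left 2 Nat.lt_two_pow_self

theorem tower_strictMono (k : ℕ) : StrictMono (tower k) :=
  strictMono_nat_of_lt_succ fun j => by
    have := two_mul_tower_le_succ k j
    have := (tower k j).pos
    rw [← PNat.coe_lt_coe]
    lia

theorem tower_mono (k : ℕ) {i j : ℕ} (h : i ≤ j) : (tower k i : ℝ) ≤ tower k j := by
  exact_mod_cast (tower_strictMono k).monotone h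

theorem two_mul_tower_le (k : ℕ) {i j : ℕ} (h : i < j) : 2 * (tower k i : ℝ) ≤ tower k j :=
  le_trans (by exact_mod_cast two_mul_tower_le_succ k i) (tower_mono k (Nat.succ_le_of_lt h))

theorem exists_tower_eq_pow (k j : ℕ) :
    ∃ e ≠ 0, (tower k j : ℕ) = Nat.nth Nat.Prime k ^ e := by
  cases j with
  | zero => exact ⟨1, one_ne_zero, by rw [tower_zero, pow_one]⟩
  | succ j => exact ⟨tower k j, (tower k j).ne_zero, tower_succ k j⟩

theorem tower_ne_tower {k l : ℕ} (h : k ≠ l) (i j : ℕ) : tower k i ≠ tower l j := by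
  intro heq
  obtain ⟨d, hd0, hd⟩ := exists_tower_eq_pow k i
  obtain ⟨e, -, he⟩ := exists_tower_eq_pow l j
  have hdvd : Nat.nth Nat.Prime k ∣ Nat.nth Nat.Prime l ^ e := by
    rw [← he, ← heq, hd]
    exact dvd_pow_self _ hd0
  have hk := Nat.prime_nth_prime k
  have hl := Nat.prime_nth_prime l
  exact h (Nat.nth_injective Nat.infinite_setOfPred_prime
    ((Nat.prime_dvd_prime_iff_eq hk hl).1 (hk.dvd_of_dvd_pow hdvd)))

theorem tendsto_tower_atTop (j : ℕ) : Tendsto (fun k => (tower k j : ℕ)) atTop atTop := by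
  refine tendsto_atTop_mono (fun k => ?_) tendsto_id
  calc k ≤ k + 2 := Nat.le_add_right k 2
    _ ≤ Nat.nth Nat.Prime k := Nat.add_two_le_nth_prime k
    _ = tower k 0 := (tower_zero k).symm
    _ ≤ tower k j := (tower_strictMono k).monotone (Nat.zero_le j)

/-- The product `N_{k,1} ⋯ N_{k,q}` of the first `q` entries of the `k`-th tower, which is the
order of magnitude of the norm `|f_k|_q`. -/
noncomputable def towerProd (k q : ℕ) : ℝ := ∏ i ∈ Finset.range q, (tower k i : ℝ)

theorem towerProd_pos (k q : ℕ) : 0 < towerProd k q := Finset.prod_pos fun _ _ => pnat_pos _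

theorem towerProd_mul_pow_le (k j d : ℕ) :
    towerProd k j * (tower k j : ℝ) ^ d ≤ towerProd k (j + d) := by
  rw [towerProd, towerProd, Finset.prod_range_add]
  gcongr
  calc (tower k j : ℝ) ^ d = ∏ _i ∈ Finset.range d, (tower k j : ℝ) := by simp
    _ ≤ ∏ i ∈ Finset.range d, (tower k (j + i) : ℝ) :=
      Finset.prod_le_prod (fun _ _ => (pnat_pos _).le) fun i _ =>
        tower_mono k (Nat.le_add_right j i)

theorem towerProd_add_le (k q d : ℕ) :
    towerProd k (q + d) ≤ towerProd k q * ((tower k (q + d) : ℝ) / 2) ^ d := by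
  rw [towerProd, towerProd, Finset.prod_range_add]
  gcongr
  calc ∏ i ∈ Finset.range d, (tower k (q + i) : ℝ)
      ≤ ∏ _i ∈ Finset.range d, ((tower k (q + d) : ℝ) / 2) :=
        Finset.prod_le_prod (fun _ _ => (pnat_pos _).le) fun i hi => by
          have := two_mul_tower_le k (Nat.add_lt_add_left (Finset.mem_range.1 hi) q)
          linarith
    _ = ((tower k (q + d) : ℝ) / 2) ^ d := by rw [Finset.prod_const, Finset.card_range]

theorem towerProd_le_pow (k q : ℕ) : towerProd k q ≤ (tower k q : ℝ) ^ q := by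
  calc towerProd k q ≤ ∏ _i ∈ Finset.range q, (tower k q : ℝ) :=
        Finset.prod_le_prod (fun _ _ => (pnat_pos _).le) fun i hi =>
          tower_mono k (Finset.mem_range.1 hi).le
    _ = (tower k q : ℝ) ^ q := by simp

theorem tower_le_towerProd_succ (k q : ℕ) : (tower k q : ℝ) ≤ towerProd k (q + 1) := by
  rw [towerProd, Finset.prod_range_succ]
  exact le_mul_of_one_le_left (pnat_pos _).le
    (Finset.one_le_prod fun i _ => one_le_pnat _)

end Tower

section Coefficients

theorem rawCoeff_pos (k j : ℕ) : 0 < rawCoeff k j :=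
  div_pos (towerProd_pos k j) (pow_pos (pnat_pos _) _)

theorem rawCoeff_mul_pow_self (k q : ℕ) : rawCoeff k q * (tower k q : ℝ) ^ q = towerProd k q :=
  div_mul_cancel₀ _ (pow_pos (pnat_pos _) _).ne'

theorem rawCoeff_mul_pow_le (k q j : ℕ) :
    rawCoeff k j * (tower k j : ℝ) ^ q ≤ towerProd k q * 2 ^ q * (1 / 2) ^ j := by
  rcases le_total j q with h | h <;> obtain ⟨d, rfl⟩ := Nat.exists_eq_add_of_le h
  · calc rawCoeff k j * (tower k j : ℝ) ^ (j + d)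
        = towerProd k j * (tower k j : ℝ) ^ d := by rw [pow_add, ← mul_assoc, rawCoeff_mul_pow_self]
      _ ≤ towerProd k (j + d) := towerProd_mul_pow_le k j d
      _ ≤ towerProd k (j + d) * 2 ^ d :=
        le_mul_of_one_le_right (towerProd_pos _ _).le (one_le_pow₀ one_le_two)
      _ = towerProd k (j + d) * 2 ^ (j + d) * (1 / 2) ^ j := by
        rw [pow_add, one_div_pow]
        field_simp
  · have hN := pnat_pos (tower k (q + d))
    refine le_of_mul_le_mul_right ?_ (pow_pos hN d)
    calc rawCoeff k (q + d) * (tower k (q + d) : ℝ) ^ q * (tower k (q + d) : ℝ) ^ d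
        = towerProd k (q + d) := by rw [mul_assoc, ← pow_add, rawCoeff_mul_pow_self]
      _ ≤ towerProd k q * ((tower k (q + d) : ℝ) / 2) ^ d := towerProd_add_le k q d
      _ = towerProd k q * 2 ^ q * (1 / 2) ^ (q + d) * (tower k (q + d) : ℝ) ^ d := by
        rw [pow_add, one_div_pow, one_div_pow, div_pow]
        field_simp

theorem rawCoeff_sq_le (k j : ℕ) : rawCoeff k j ^ 2 ≤ (1 / 2) ^ j := by
  have hle : rawCoeff k j ≤ (1 / 2) ^ j := by simpa [towerProd] using rawCoeff_mul_pow_le k 0 j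
  have hle_one : rawCoeff k j ≤ 1 := hle.trans (pow_le_one₀ (by norm_num) (by norm_num))
  exact (pow_le_of_le_one (rawCoeff_pos k j).le hle_one two_ne_zero).trans hle

theorem summable_rawCoeff_sq (k : ℕ) : Summable fun j => rawCoeff k j ^ 2 :=
  .of_nonneg_of_le (fun _ => sq_nonneg _) (rawCoeff_sq_le k) summable_geometric_two

theorem one_le_tsum_rawCoeff_sq (k : ℕ) : 1 ≤ ∑' j, rawCoeff k j ^ 2 := by
  simpa [rawCoeff] using (summable_rawCoeff_sq k).le_tsum 0 fun _ _ => sq_nonneg _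

theorem tsum_rawCoeff_sq_le_two (k : ℕ) : ∑' j, rawCoeff k j ^ 2 ≤ 2 :=
  ((summable_rawCoeff_sq k).tsum_le_tsum (rawCoeff_sq_le k)
    summable_geometric_two).trans_eq tsum_geometric_two

theorem coeff_le_rawCoeff (k j : ℕ) : coeff k j ≤ rawCoeff k j :=
  mul_le_of_le_one_left (rawCoeff_pos k j).le
    (inv_le_one_of_one_le₀ (Real.one_le_sqrt.2 (one_le_tsum_rawCoeff_sq k)))

theorem rawCoeff_div_two_le_coeff (k j : ℕ) : rawCoeff k j / 2 ≤ coeff k j := by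
  have hlow := one_le_tsum_rawCoeff_sq k
  have hsqrt_le : √(∑' i, rawCoeff k i ^ 2) ≤ 2 :=
    Real.sqrt_le_iff.2 ⟨by norm_num, by linarith [tsum_rawCoeff_sq_le_two k]⟩
  have hsqrt_pos : 0 < √(∑' i, rawCoeff k i ^ 2) := Real.sqrt_pos.2 (by linarith)
  rw [coeff, div_eq_inv_mul]
  exact mul_le_mul_of_nonneg_right (inv_anti₀ hsqrt_pos hsqrt_le) (rawCoeff_pos k j).le

theorem coeff_nonneg (k j : ℕ) : 0 ≤ coeff k j :=
  (half_pos (rawCoeff_pos k j)).le.trans (rawCoeff_div_two_le_coeff k j)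

theorem tsum_coeff_sq (k : ℕ) : ∑' j, coeff k j ^ 2 = 1 := by
  have hlow := one_le_tsum_rawCoeff_sq k
  simp only [coeff, mul_pow]
  rw [tsum_mul_left, inv_pow, Real.sq_sqrt (by linarith), inv_mul_cancel₀ (by linarith)]

theorem wnorm_coeff_smul_unit (k q j : ℕ) :
    wnorm q ⇑((coeff k j : ℂ) • RapidSeq.unit (tower k j)) = coeff k j * (tower k j : ℝ) ^ q := by
  rw [RapidSeq.coe_smul, wnorm_smul, Complex.norm_of_nonneg (coeff_nonneg k j), ← zpow_natCast]
  exact congrArg _ (wnorm_single q (tower k j))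

theorem wnorm_coeff_smul_unit_le (k q j : ℕ) :
    wnorm q ⇑((coeff k j : ℂ) • RapidSeq.unit (tower k j)) ≤
      towerProd k q * 2 ^ q * (1 / 2) ^ j := by
  rw [wnorm_coeff_smul_unit]
  exact (mul_le_mul_of_nonneg_right (coeff_le_rawCoeff k j) (pow_nonneg (pnat_pos _).le _)).trans
    (rawCoeff_mul_pow_le k q j)

theorem summable_wnorm_coeff_smul_unit (k q : ℕ) :
    Summable fun j => wnorm q ⇑((coeff k j : ℂ) • RapidSeq.unit (tower k j)) :=
  .of_nonneg_of_le (fun _ => wnorm_nonneg _ _) (wnorm_coeff_smul_unit_le k q)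
    (summable_geometric_two.mul_left _)

end Coefficients

section TowerVector

/-- The vector `f_k = ∑_j a_{k,j} e_{N_{k,j}}` of the theorem, as an element of `s`. -/
noncomputable def towerVector (k : ℕ) : RapidSeq :=
  ∑' j, (coeff k j : ℂ) • RapidSeq.unit (tower k j)

theorem hasSum_towerVector (k : ℕ) :
    HasSum (fun j => (coeff k j : ℂ) • RapidSeq.unit (tower k j)) (towerVector k) :=
  (RapidSeq.summable_of_summable_wnorm (summable_wnorm_coeff_smul_unit k)).hasSum

theorem hasSum_towerVector_apply (k : ℕ) (i : ℕ+) :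
    HasSum (fun j => (coeff k j : ℂ) * (Pi.single (tower k j) 1 : ℕ+ → ℂ) i) (towerVector k i) :=
  Pi.hasSum.1 ((hasSum_towerVector k).mapL RapidSeq.coeL) i

theorem towerVector_apply_tower (k j : ℕ) : towerVector k (tower k j) = coeff k j := by
  refine (hasSum_towerVector_apply k _).unique ?_
  convert hasSum_single j fun i hi => ?_ using 1
  · simp
  · rw [Pi.single_eq_of_ne ((tower_strictMono k).injective.ne hi.symm), mul_zero]

theorem towerVector_apply_of_notMem_range {k : ℕ} {i : ℕ+} (hi : i ∉ Set.range (tower k)) :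
    towerVector k i = 0 := by
  refine (hasSum_towerVector_apply k i).unique (hasSum_zero.congr_fun fun j => ?_)
  rw [Pi.single_eq_of_ne (fun h => hi ⟨j, h.symm⟩), mul_zero]

theorem isOrthonormal_towerVector : IsOrthonormal towerVector := by
  refine ⟨fun k => ?_, fun k l hkl => ?_⟩
  · have hsupp : Function.support (fun i => towerVector k i * conj (towerVector k i)) ⊆
        Set.range (tower k) := fun i hi => by
      by_contra hcon
      exact hi (by simp only [towerVector_apply_of_notMem_range hcon, zero_mul])
    calc pair (towerVector k) (towerVector k)
        = ∑' j, towerVector k (tower k j) * conj (towerVector k (tower k j)) :=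
          ((tower_strictMono k).injective.tsum_eq hsupp).symm
      _ = ∑' j, ((coeff k j ^ 2 : ℝ) : ℂ) := tsum_congr fun j => by
          rw [towerVector_apply_tower, Complex.conj_ofReal, Complex.ofReal_pow, sq]
      _ = 1 := by rw [← Complex.ofReal_tsum, tsum_coeff_sq, Complex.ofReal_one]
  · refine (tsum_congr fun i => ?_).trans tsum_zero
    by_cases hi : i ∈ Set.range (tower k)
    · obtain ⟨j, rfl⟩ := hi
      have hl : tower k j ∉ Set.range (tower l) := fun ⟨m, hm⟩ => tower_ne_tower hkl j m hm.symm
      rw [towerVector_apply_of_notMem_range hl, map_zero, mul_zero]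
    · rw [towerVector_apply_of_notMem_range hi, zero_mul]

theorem towerProd_div_two_le_wnorm (k q : ℕ) : towerProd k q / 2 ≤ wnorm q (towerVector k) := by
  calc towerProd k q / 2 = rawCoeff k q / 2 * (tower k q : ℝ) ^ q := by
        rw [← rawCoeff_mul_pow_self, mul_div_right_comm]
    _ ≤ coeff k q * (tower k q : ℝ) ^ q :=
        mul_le_mul_of_nonneg_right (rawCoeff_div_two_le_coeff k q) (pow_nonneg (pnat_pos _).le _)
    _ = ‖towerVector k (tower k q)‖ * (tower k q : ℝ) ^ q := by
        rw [towerVector_apply_tower, Complex.norm_of_nonneg (coeff_nonneg k q)]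
    _ ≤ wnorm q (towerVector k) := (towerVector k).norm_apply_mul_pow_le q _

theorem wnorm_towerVector_le (k q : ℕ) : wnorm q (towerVector k) ≤ 2 ^ (q + 1) * towerProd k q := by
  calc wnorm q (towerVector k)
      ≤ ∑' j, wnorm q ⇑((coeff k j : ℂ) • RapidSeq.unit (tower k j)) :=
        RapidSeq.wnorm_tsum_le (summable_wnorm_coeff_smul_unit k) q
    _ ≤ ∑' j : ℕ, towerProd k q * 2 ^ q * (1 / 2) ^ j :=
        (summable_wnorm_coeff_smul_unit k q).tsum_le_tsum (wnorm_coeff_smul_unit_le k q)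
          (summable_geometric_two.mul_left _)
    _ = 2 ^ (q + 1) * towerProd k q := by
        rw [tsum_mul_left, tsum_geometric_two]
        ring

theorem wnorm_towerVector_isBigO (p : ℕ) :
    (fun k => wnorm p (towerVector k)) =O[atTop] fun k => (tower k p : ℝ) ^ p := by
  refine .of_bound (2 ^ (p + 1)) (.of_forall fun k => ?_)
  have hN := pnat_pos (tower k p)
  rw [Real.norm_of_nonneg (wnorm_nonneg _ _), Real.norm_of_nonneg (pow_pos hN p).le]
  exact (wnorm_towerVector_le k p).trans (by gcongr; exact towerProd_le_pow k p)

theorem two_pow_tower_isBigO_wnorm (p : ℕ) :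
    (fun k => (2 : ℝ) ^ (tower k p : ℕ)) =O[atTop] fun k => wnorm (p + 2 : ℕ) (towerVector k) := by
  refine .of_bound 2 (.of_forall fun k => ?_)
  rw [Real.norm_of_nonneg (by positivity), Real.norm_of_nonneg (wnorm_nonneg _ _)]
  calc (2 : ℝ) ^ (tower k p : ℕ) ≤ tower k (p + 1) := by exact_mod_cast two_pow_tower_le k p
    _ ≤ towerProd k (p + 2) := tower_le_towerProd_succ k (p + 1)
    _ ≤ 2 * wnorm (p + 2 : ℕ) (towerVector k) := by
        linarith [towerProd_div_two_le_wnorm k (p + 2)]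

theorem not_wnorm_towerVector_isBigO_pow (p r : ℕ) :
    ¬ (fun k => wnorm (p + 2 : ℕ) (towerVector k)) =O[atTop]
      fun k => wnorm p (towerVector k) ^ r := by
  intro h
  have hexp_le : (fun k => (2 : ℝ) ^ (tower k p : ℕ)) =O[atTop]
      fun k => (tower k p : ℝ) ^ (p * r) := by
    simpa only [pow_mul] using
      (two_pow_tower_isBigO_wnorm p).trans (h.trans ((wnorm_towerVector_isBigO p).pow r))
  have hpow_lt : (fun k => (tower k p : ℝ) ^ (p * r)) =o[atTop]
      fun k => (2 : ℝ) ^ (tower k p : ℕ) :=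
    (isLittleO_pow_const_const_pow_of_one_lt (p * r) one_lt_two).comp_tendsto
      (tendsto_tower_atTop p)
  exact hexp_le.not_isLittleO (.of_forall fun k => (pow_pos two_pos _).ne') hpow_lt

theorem not_isoAlg_projAlg_towerVector {F : NonUnitalStarSubalgebra ℂ RapidSeq}
    (hF : IsClosed (F : Set RapidSeq)) : ¬ IsoAlg (projAlg towerVector) F := by
  intro h
  obtain ⟨p, hp⟩ :=
    exists_forall_exists_isBigO_wnorm_pow_of_isoAlg isOrthonormal_towerVector hF h
  obtain ⟨r, hr⟩ := hp (p + 2)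
  exact not_wnorm_towerVector_isBigO_pow p r hr

end TowerVector

theorem IsoFrechetStarAlg.isoAlg {A B : Type*} [NonUnitalRing A] [NonUnitalRing B] [Module ℂ A]
    [Module ℂ B] [Star A] [Star B] [TopologicalSpace A] [TopologicalSpace B]
    (h : IsoFrechetStarAlg A B) : IsoAlg A B := by
  obtain ⟨Φ, -, -⟩ := h
  exact ⟨{ Φ.toEquiv with map_add' := map_add Φ, map_smul' := map_smul Φ }, map_mul Φ⟩

end SmoothOp

theorem mainTheorem2 :
    ∃ f : ℕ → RapidSeq,
      (∀ k, HasSum (fun j : ℕ => (coeff k j : ℂ) • RapidSeq.unit (tower k j)) (f k)) ∧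
      (∀ k l, pair (f k) (f l) = if k = l then 1 else 0) ∧
      ∃ E : NonUnitalStarSubalgebra ℂ Op,
        E = alg (Set.range fun k => rankOne (f k) (f k)) ∧
        IsClosed (E : Set Op) ∧
        (∀ x ∈ E, ∀ y ∈ E, x * y = y * x) ∧
        ∀ F : NonUnitalStarSubalgebra ℂ RapidSeq, IsClosed (F : Set RapidSeq) →
          ¬ IsoFrechetStarAlg E F ∧ ¬ IsoAlg E F := by
  have hf := isOrthonormal_towerVector
  refine ⟨towerVector, hasSum_towerVector, fun k l => ?_, projAlg towerVector, rfl,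
    isClosed_alg _, hf.projAlg_commute, fun F hF => ?_⟩
  · split_ifs with hkl
    · exact hkl ▸ hf.1 k
    · exact hf.2 hkl
  · have hiso := not_isoAlg_projAlg_towerVector hF
    exact ⟨fun h => hiso h.isoAlg, hiso⟩
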